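/- Work over $\mathbb{C}$. Let $r\geq 2$, let $\mathbf{n}=(n_1,\dots,n_r)$ and $\mathbf{d}=(d_1,\dots,d_r)$ be tuples of positive integers with $n_1\leq\dots\leq n_r$, and let $SV^{\mathbf{n}}_{\mathbf{d}}\subset\mathbb{P}^N$, $N=\prod_{i}\binom{n_i+d_i}{d_i}-1$, be the Segre–Veronese variety, that is, $\mathbb{P}^{n_1}\times\dots\times\mathbb{P}^{n_r}$ embedded by the complete linear system $|\mathcal{O}(d_1,\dots,d_r)|$. Put $d=\min\{d_1,\dots,d_r\}$. For integers $m,k\geq 0$ define $h_m(k)$ as follows: write $k+1=2^{\lambda_1}+\dots+2^{\lambda_a}+\varepsilon$ with $\lambda_1>\dots>\lambda_a\geq 1$ and $\varepsilon\in\{0,1\}$; then $h_m(k)=m^{\lambda_1-1}+\dots+m^{\lambda_a-1}$ (so $h_m(0)=0$). A smooth irreducible non-degenerate variety $X\subset\mathbb{P}^N$ is called $h$-weakly defective if, for general points $x_1,\dots,x_h\in X$ and a general hyperplane $H$ containing $\langle T_{x_1}X,\dots,T_{x_h}X\rangle$, the union of those irreducible components of $\mathrm{Sing}(X\cap H)$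 (the locus of points of $X$ where $H$ is tangent to $X$) that contain at least one of the $x_i$ has positive dimension. It is called $h$-defective if $\dim \mathbb{S}ec_h(X)<\min\{h\dim X+h-1,N\}$, where $\mathbb{S}ec_h(X)$ is the Zariski closure of the union of the linear spans of $h$ points of $X$. Theorem. Let $h\geq 1$ be an integer, and assume that at least one of the following holds: 1. $h\leq (n_1+1)\,h_{n_1+1}(d-1)$; 2. $h\leq (n_1+1)\,h_{n_1+1}(d)$ and $d=d_1\leq d_i-2$ for all $2\leq i\leq r$; 3. $d\geq 2$ and $h\leq (n_1+1)^{\lfloor\log_2 d\rfloor}$. Then $SV^{\mathbf{n}}_{\mathbf{d}}$ is not $h$-weakly defective, and it is not $h$-defective. -/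

import Mathlib

open scoped LinearAlgebra.Projectivization

noncomputable section

namespace SegreVeronese

/-! ### Zariski topologies -/

/-- The Zariski topology on the affine space `ℂ^σ`, with the basic open sets `{F ≠ 0}`. -/
@[reducible] def affineZariski (σ : Type*) : TopologicalSpace (σ → ℂ) :=
  TopologicalSpace.generateFrom
    {U | ∃ F : MvPolynomial σ ℂ, U = {v | MvPolynomial.eval v F ≠ 0}}

/-- The Zariski topology on the projective space of lines in `ℂ^ι`: a set is open if and only if
its preimage in `ℂ^ι ∖ {0}` is Zariski open. -/
@[reducible] def projZariski (ι : Type*) : TopologicalSpace (ℙ ℂ (ι → ℂ)) :=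
  TopologicalSpace.coinduced
    (fun v : {v : ι → ℂ // v ≠ 0} => Projectivization.mk ℂ v.1 v.2)
    (TopologicalSpace.induced Subtype.val (affineZariski ι))

/-- The Zariski topology on the product variety of `h` copies of a projective space (finer than
the product topology): a set is open if and only if its preimage in `(ℂ^ι ∖ {0})^h` is Zariski
open. -/
@[reducible] def multiProjZariski (h : ℕ) (ι : Type*) : TopologicalSpace (Fin h → ℙ ℂ (ι → ℂ)) :=
  TopologicalSpace.coinduced
    (fun (v : {v : Fin h → ι → ℂ // ∀ i, v i ≠ 0}) (i : Fin h) =>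
      Projectivization.mk ℂ (v.1 i) (v.2 i))
    (TopologicalSpace.induced (fun v (p : Fin h × ι) => v.1 p.1 p.2)
      (affineZariski (Fin h × ι)))

/-! ### Subsets of projective space -/

section Projective

variable {ι : Type*}

/-- The affine cone over `Y`, without its vertex. -/
def cone (Y : Set (ℙ ℂ (ι → ℂ))) : Set (ι → ℂ) :=
  {v | ∃ hv : v ≠ 0, Projectivization.mk ℂ v hv ∈ Y}

/-- The homogeneous ideal of `Y`. -/
def homIdeal (Y : Set (ℙ ℂ (ι → ℂ))) : Ideal (MvPolynomial ι ℂ) :=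
  MvPolynomial.vanishingIdeal ℂ (cone Y)

/-- The dimension of (the Zariski closure of) `Y`: the transcendence degree over `ℂ` of the
homogeneous coordinate ring of `Y`, minus one. It is `-1` for the empty set, `0` for a point, and
the largest dimension of a component if `Y` is reducible. -/
def projDim (Y : Set (ℙ ℂ (ι → ℂ))) : ℤ :=
  (Cardinal.toNat (Algebra.trdeg ℂ (MvPolynomial ι ℂ ⧸ homIdeal Y)) : ℤ) - 1

variable [Fintype ι]

/-- The embedded projective tangent space `T_x X`, as a linear subspace of `ℂ^ι`: the common
kernel of the differentials at `x` of the polynomials in the homogeneous ideal of `X`. -/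
def tangentSpace (X : Set (ℙ ℂ (ι → ℂ))) (x : ℙ ℂ (ι → ℂ)) : Submodule ℂ (ι → ℂ) where
  carrier := {w | ∀ F ∈ homIdeal X,
    ∑ a, MvPolynomial.eval x.rep (MvPolynomial.pderiv a F) * w a = 0}
  zero_mem' := by intro F _; simp
  add_mem' := by
    intro v w hv hw F hF
    simp only [Pi.add_apply, mul_add, Finset.sum_add_distrib]
    rw [hv F hF, hw F hF, add_zero]
  smul_mem' := by
    intro c w hw F hF
    simp only [Pi.smul_apply, smul_eq_mul, mul_left_comm _ c, ← Finset.mul_sum]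
    rw [hw F hF, mul_zero]

/-- The linear subspace of `ℂ^ι` underlying the hyperplane `H`. A hyperplane is a point of the dual
projective space, given by the coefficients of its equation. -/
def hyperplane (H : ℙ ℂ (ι → ℂ)) : Submodule ℂ (ι → ℂ) where
  carrier := {w | H.rep ⬝ᵥ w = 0}
  zero_mem' := by simp
  add_mem' := by
    intro v w hv hw
    simp only [Set.mem_ofPred_eq, dotProduct_add] at *
    rw [hv, hw, add_zero]
  smul_mem' := by
    intro c w hw
    simp only [Set.mem_ofPred_eq, dotProduct_smul] at *
    rw [hw, smul_zero]

/-- The points of `X` at which the hyperplane `H` is tangent to `X`; for a smooth `X` not contained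
in `H` this is the singular locus of the scheme `X ∩ H`. -/
def tangencyLocus (X : Set (ℙ ℂ (ι → ℂ))) (H : ℙ ℂ (ι → ℂ)) : Set (ℙ ℂ (ι → ℂ)) :=
  {y | y ∈ X ∧ tangentSpace X y ≤ hyperplane H}

/-- `Z` is an irreducible component of `C`, for the Zariski topology. -/
def IsComponent (Z C : Set (ℙ ℂ (ι → ℂ))) : Prop :=
  Maximal (fun S => @IsIrreducible _ (projZariski ι) S ∧ S ⊆ C) Z

/-- The contact locus of `X` with respect to `x₁, …, x_h, H`: the union of the irreducible
components of the singular locus of `X ∩ H` that contain at least one of the `x_i`. -/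
def contactLocus (X : Set (ℙ ℂ (ι → ℂ))) {h : ℕ} (x : Fin h → ℙ ℂ (ι → ℂ))
    (H : ℙ ℂ (ι → ℂ)) : Set (ℙ ℂ (ι → ℂ)) :=
  ⋃₀ {Z | IsComponent Z (tangencyLocus X H) ∧ ∃ i, x i ∈ Z}

/-- The hyperplanes containing the span of the tangent spaces of `X` at `x₁, …, x_h`. -/
def tangentHyperplanes (X : Set (ℙ ℂ (ι → ℂ))) {h : ℕ} (x : Fin h → ℙ ℂ (ι → ℂ)) :
    Set (ℙ ℂ (ι → ℂ)) :=
  {H | (⨆ i, tangentSpace X (x i)) ≤ hyperplane H}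

/-- `X` is `h`-weakly defective: for general `x₁, …, x_h ∈ X` and a general hyperplane `H` that
contains `⟨T_{x₁} X, …, T_{x_h} X⟩`, the contact locus has positive dimension. Here
"general" means: in some nonempty Zariski open subset, of `X^h` and of the linear system of these
hyperplanes respectively. -/
def IsWeaklyDefective (X : Set (ℙ ℂ (ι → ℂ))) (h : ℕ) : Prop :=
  ∃ U : Set (Fin h → ℙ ℂ (ι → ℂ)), @IsOpen _ (multiProjZariski h ι) U ∧
    (∃ x ∈ U, ∀ i, x i ∈ X) ∧
    ∀ x ∈ U, (∀ i, x i ∈ X) →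
      ∃ W : Set (ℙ ℂ (ι → ℂ)), @IsOpen _ (projZariski ι) W ∧
        (W ∩ tangentHyperplanes X x).Nonempty ∧
        ∀ H ∈ W ∩ tangentHyperplanes X x, 0 < projDim (contactLocus X x H)

/-- The `h`-secant variety: the Zariski closure of the union of the linear spans of `h` points
of `X`. -/
def secantVariety (X : Set (ℙ ℂ (ι → ℂ))) (h : ℕ) : Set (ℙ ℂ (ι → ℂ)) :=
  @closure _ (projZariski ι)
    {p | ∃ x : Fin h → ℙ ℂ (ι → ℂ), (∀ i, x i ∈ X) ∧
      p.rep ∈ Submodule.span ℂ (Set.range fun i => (x i).rep)}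

/-- `X ⊂ ℙ^N` is `h`-defective: `dim Sec_h(X) < min {h · dim X + h - 1, N}`. -/
def IsDefective (X : Set (ℙ ℂ (ι → ℂ))) (h : ℕ) : Prop :=
  projDim (secantVariety X h) <
    min ((h : ℤ) * projDim X + h - 1) ((Fintype.card ι : ℤ) - 1)

end Projective

/-! ### Segre-Veronese varieties -/

/-- The monomials of multidegree `(d₁, …, d_r)` in `r` groups of `n_i + 1` variables: one multiset
of `d_i` variables of the `i`-th group for each `i`. -/
abbrev MonomialIndex {r : ℕ} (n d : Fin r → ℕ) : Type :=
  (i : Fin r) → Sym (Fin (n i + 1)) (d i)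

/-- All monomials of multidegree `(d₁, …, d_r)`, evaluated at `x`. -/
def monomialMap {r : ℕ} (n d : Fin r → ℕ) (x : (i : Fin r) → Fin (n i + 1) → ℂ) :
    MonomialIndex n d → ℂ :=
  fun J => ∏ i, ((J i : Multiset (Fin (n i + 1))).map (x i)).prod

/-- The Segre-Veronese variety: the image of `ℙ^{n₁} × ⋯ × ℙ^{n_r}` under the embedding by the
complete linear system `|𝒪(d₁, …, d_r)|`. -/
def segreVeronese {r : ℕ} (n d : Fin r → ℕ) : Set (ℙ ℂ (MonomialIndex n d → ℂ)) :=
  {p | ∃ x : (i : Fin r) → Fin (n i + 1) → ℂ, (∀ i, x i ≠ 0) ∧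
    ∃ hx : monomialMap n d x ≠ 0, p = Projectivization.mk ℂ (monomialMap n d x) hx}

/-- The function `h_m`: if `k + 1 = 2^{l₁} + ⋯ + 2^{l_a} + ε` with `l₁ > ⋯ > l_a ≥ 1` and
`ε ∈ {0, 1}`, then `h_m(k) = m^{l₁ - 1} + ⋯ + m^{l_a - 1}`; in particular `h_m(0) = 0`. -/
def osculatingCount (m k : ℕ) : ℕ :=
  ∑ l ∈ Finset.Icc 1 (k + 1), if (k + 1).testBit l then m ^ (l - 1) else 0

end SegreVeronese

end

noncomputable section

namespace SegreVeronese

open MvPolynomial Filter Topology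
open scoped LinearAlgebra.Projectivization

/-! ### Polynomial functions and genericity -/

section Analysis

variable {σ : Type*} [Fintype σ]

/-! On the standard affine chart, linear forms on the ambient space restrict exactly to the
polynomials of multidegree at most `d` (`exists_chartForm_eq`). A hyperplane is tangent at a chart
point if and only if its polynomial is singular there (`tangentSpace_le_hyperplane_iff`). Both
claims then follow from one special `h`-tuple of points at which (a) the 1-jets are independent and
(b) for each point some polynomial, singular at the whole tuple, has a nondegenerate Hessian there.
By Terracini's argument, (a) gives the expected dimension of the secant variety
(`not_isDefective_of_special`). With (a), property (b) spreads to general tuples. For a general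
tangent hyperplane every `x_i` is then an isolated tangency point, so the contact locus is finite
(`not_isWeaklyDefective_of_special`).

The special points are diagonal: the same `q i` in `n₁` coordinates is placed in every factor and
padded with zeros. If `h` is at most the number of monomials of degree at most `e` in `n₁`
variables, there are points `q i` and polynomials `G i` of degree at most `e` with `G i (q j) =
δ_ij` (`exists_dual_points`). Multiplying a test polynomial of small degree by copies of `G i` in
two different factors makes it singular at the other points and keeps its leading jet at the `i`-th
one. This costs degree `e` in each of the two factors, so `e = d - 1` is affordable. When the other
degrees exceed `d₁ = d` by two, a corrected product allows `e = d`. The nondegenerate Hessian is a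
permutation matrix, from a quadratic form pairing coordinates of two factors.

The numerical bounds follow because `(N + 1)` times the number of monomials of degree at most `e`
does not exceed the number of those of degree at most `2e + 1`; iterating this along binary digits
produces `h_m`. -/

theorem contDiff_eval (P : MvPolynomial σ ℂ) :
    ContDiff ℂ 1 fun v : σ → ℂ => eval v P := by
  induction P using MvPolynomial.induction_on with
  | C a => simpa using contDiff_const
  | add p q hp hq => simpa using hp.add hq
  | mul_X p i hp => simpa using hp.mul (contDiff_apply ℂ ℂ i)

theorem differentiable_eval (P : MvPolynomial σ ℂ) :
    Differentiable ℂ fun v : σ → ℂ => eval v P :=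
  (contDiff_eval P).differentiable one_ne_zero

theorem hasDerivAt_eval (P : MvPolynomial σ ℂ) {γ : ℂ → σ → ℂ} {γ' : σ → ℂ} {s : ℂ}
    (hγ : ∀ a, HasDerivAt (fun s => γ s a) (γ' a) s) :
    HasDerivAt (fun s => eval (γ s) P) (∑ a, eval (γ s) (pderiv a P) * γ' a) s := by
  classical
  induction P using MvPolynomial.induction_on with
  | C a => simpa using hasDerivAt_const s a
  | add p q hp hq =>
    simp only [map_add, add_mul, Finset.sum_add_distrib]
    exact hp.fun_add hq
  | mul_X p i hp =>
    have := hp.fun_mul (hγ i)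
    simp_rw [map_mul, eval_X]
    refine this.congr_deriv (Eq.symm ?_)
    simp only [Derivation.leibniz, pderiv_X, smul_eq_mul, map_add, map_mul, eval_X, add_mul,
      Finset.sum_add_distrib]
    rw [add_comm]
    congr 1
    · rw [Finset.sum_mul]
      exact Finset.sum_congr rfl fun a _ => by ring
    · rw [Finset.sum_eq_single i]
      · simp
      · intro b _ hb
        simp [hb.symm]
      · simp

/-- Near `a` the function `f` stays nonzero, while by the identity theorem `g` has only isolated
zeros. -/
theorem exists_ne_zero_and_ne_zero {f g : ℂ → ℂ} (hf : Differentiable ℂ f)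
    (hg : Differentiable ℂ g) {a b : ℂ} (ha : f a ≠ 0) (hb : g b ≠ 0) :
    ∃ s, f s ≠ 0 ∧ g s ≠ 0 := by
  have h1 : ∀ᶠ s in 𝓝[≠] a, f s ≠ 0 :=
    (hf.continuous.continuousAt.eventually_ne ha).filter_mono nhdsWithin_le_nhds
  have h2 : ∀ᶠ s in 𝓝[≠] a, g s ≠ 0 := by
    rcases ((hg.analyticAt a).eventually_eq_zero_or_eventually_ne_zero) with h | h
    · have hA : AnalyticOnNhd ℂ g Set.univ := fun z _ => hg.analyticAt z
      have := hA.eqOn_zero_of_preconnected_of_eventuallyEq_zero isPreconnected_univ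
        (Set.mem_univ a) h
      exact absurd (this (Set.mem_univ b)) hb
    · exact h
  exact (h1.and h2).exists

theorem differentiable_prod {E κ : Type*} [NormedAddCommGroup E] [NormedSpace ℂ E]
    (s : Finset κ) {f : κ → E → ℂ} (hf : ∀ i ∈ s, Differentiable ℂ (f i)) :
    Differentiable ℂ fun v => ∏ i ∈ s, f i v := by
  classical
  induction s using Finset.induction_on with
  | empty => simp
  | insert j s hj ih =>
    simp only [Finset.prod_insert hj]
    exact (hf j (Finset.mem_insert_self j s)).fun_mul
      (ih fun i hi => hf i (Finset.mem_insert_of_mem hi))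

/-- Reduces to one variable on the line joining two witnesses. It plays the role of irreducibility
of affine space in all genericity arguments below. -/
theorem exists_forall_ne_zero {E : Type*} [NormedAddCommGroup E] [NormedSpace ℂ E]
    {κ : Type*} (s : Finset κ) (f : κ → E → ℂ) (hf : ∀ i ∈ s, Differentiable ℂ (f i))
    (h : ∀ i ∈ s, ∃ v, f i v ≠ 0) : ∃ v, ∀ i ∈ s, f i v ≠ 0 := by
  classical
  induction s using Finset.induction_on with
  | empty => exact ⟨0, by simp⟩
  | insert j s hj ih =>
    obtain ⟨v, hv⟩ := ih (fun i hi => hf i (Finset.mem_insert_of_mem hi))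
      (fun i hi => h i (Finset.mem_insert_of_mem hi))
    obtain ⟨u, hu⟩ := h j (Finset.mem_insert_self j s)
    have hline : Differentiable ℂ fun z : ℂ => v + z • (u - v) := by fun_prop
    have h1 : Differentiable ℂ fun z : ℂ => ∏ i ∈ s, f i (v + z • (u - v)) := by
      refine differentiable_prod _ fun i hi => ?_
      exact (hf i (Finset.mem_insert_of_mem hi)).comp hline
    have h2 : Differentiable ℂ fun z : ℂ => f j (v + z • (u - v)) :=
      (hf j (Finset.mem_insert_self j s)).comp hline
    obtain ⟨z, hz1, hz2⟩ := exists_ne_zero_and_ne_zero h1 h2 (a := 0) (b := 1)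
      (by simpa [Finset.prod_ne_zero_iff] using hv) (by simpa using hu)
    refine ⟨v + z • (u - v), fun i hi => ?_⟩
    rcases Finset.mem_insert.1 hi with rfl | hi
    · exact hz2
    · exact Finset.prod_ne_zero_iff.1 hz1 i hi

theorem differentiable_det {E ρ : Type*} [NormedAddCommGroup E] [NormedSpace ℂ E] [Fintype ρ]
    [DecidableEq ρ] {A : E → Matrix ρ ρ ℂ} (hA : ∀ i j, Differentiable ℂ fun v => A v i j) :
    Differentiable ℂ fun v => (A v).det := by
  simp only [Matrix.det_apply']
  refine Differentiable.fun_sum fun g _ => (Differentiable.const_mul ?_ _)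
  exact differentiable_prod _ fun i _ => hA _ _

theorem differentiable_adjugate {E ρ : Type*} [NormedAddCommGroup E] [NormedSpace ℂ E] [Fintype ρ]
    [DecidableEq ρ] {A : E → Matrix ρ ρ ℂ} (hA : ∀ i j, Differentiable ℂ fun v => A v i j)
    (i j : ρ) : Differentiable ℂ fun v => (A v).adjugate i j := by
  simp only [Matrix.adjugate_apply]
  refine differentiable_det fun a b => ?_
  by_cases h : a = j
  · subst h; simp
  · simpa [Matrix.updateRow_ne h] using hA a b

theorem eq_zero_of_eventually_eval_eq_zero {σ : Type*} {P : MvPolynomial σ ℂ} {a : σ → ℂ}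
    (h : ∀ᶠ y in 𝓝 a, eval y P = 0) : P = 0 := by
  rw [nhds_pi, Filter.Eventually, Filter.mem_pi'] at h
  obtain ⟨I, t, ht, hsub⟩ := h
  refine funext_set t (fun i => infinite_of_mem_nhds (a i) (ht i)) fun x hx => ?_
  simpa using hsub fun i _ => hx i (Set.mem_univ i)

/-- A map with surjective strict derivative is open at the point, so `P` vanishes on a neighbourhood
of `Ψ a`. -/
theorem eq_zero_of_eval_comp_eq_zero {E : Type*} [NormedAddCommGroup E] [NormedSpace ℂ E]
    [CompleteSpace E] {P : MvPolynomial σ ℂ} {Ψ : E → σ → ℂ} {Ψ' : E →L[ℂ] σ → ℂ} {a : E}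
    (hΨ : HasStrictFDerivAt Ψ Ψ' a) (hsurj : Ψ'.range = ⊤)
    (h : ∀ᶠ x in 𝓝 a, eval (Ψ x) P = 0) : P = 0 := by
  refine eq_zero_of_eventually_eval_eq_zero (a := Ψ a) ?_
  rw [← hΨ.map_nhds_eq_of_surj hsurj]
  exact h

end Analysis

/-! ### Basic open sets -/

section ZariskiTopology

theorem exists_basicOpen {σ : Type*} {U : Set (σ → ℂ)} (hU : @IsOpen _ (affineZariski σ) U)
    {v : σ → ℂ} (hv : v ∈ U) :
    ∃ F : MvPolynomial σ ℂ, eval v F ≠ 0 ∧ ∀ w, eval w F ≠ 0 → w ∈ U := by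
  induction hU with
  | basic s hs =>
    obtain ⟨F, rfl⟩ := hs
    exact ⟨F, hv, fun w hw => hw⟩
  | univ => exact ⟨1, by simp, fun _ _ => trivial⟩
  | inter s t _ _ hs ht =>
    obtain ⟨F, hF, hF'⟩ := hs hv.1
    obtain ⟨G, hG, hG'⟩ := ht hv.2
    refine ⟨F * G, by simp [hF, hG], fun w hw => ?_⟩
    rw [map_mul] at hw
    exact ⟨hF' w (left_ne_zero_of_mul hw), hG' w (right_ne_zero_of_mul hw)⟩
  | sUnion S _ hS =>
    obtain ⟨s, hs, hvs⟩ := hv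
    obtain ⟨F, hF, hF'⟩ := hS s hs hvs
    exact ⟨F, hF, fun w hw => ⟨s, hs, hF' w hw⟩⟩

theorem exists_basicOpen_proj {ι : Type*} {W : Set (ℙ ℂ (ι → ℂ))}
    (hW : @IsOpen _ (projZariski ι) W) {v : ι → ℂ} (hv : v ≠ 0)
    (hvW : Projectivization.mk ℂ v hv ∈ W) :
    ∃ F : MvPolynomial ι ℂ, eval v F ≠ 0 ∧
      ∀ w (hw : w ≠ 0), eval w F ≠ 0 → Projectivization.mk ℂ w hw ∈ W := by
  rw [isOpen_coinduced] at hW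
  obtain ⟨U, hU, hUW⟩ := (@isOpen_induced_iff _ _ (affineZariski ι) _ _).1 hW
  have hvU : v ∈ U := by
    have : (⟨v, hv⟩ : {v : ι → ℂ // v ≠ 0}) ∈ Subtype.val ⁻¹' U := by rw [hUW]; exact hvW
    exact this
  obtain ⟨F, hF, hF'⟩ := exists_basicOpen hU hvU
  refine ⟨F, hF, fun w hw hwF => ?_⟩
  have : (⟨w, hw⟩ : {v : ι → ℂ // v ≠ 0}) ∈ Subtype.val ⁻¹' U := hF' w hwF
  rw [hUW] at this
  exact this

theorem exists_basicOpen_multiProj {h : ℕ} {ι : Type*} {W : Set (Fin h → ℙ ℂ (ι → ℂ))}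
    (hW : @IsOpen _ (multiProjZariski h ι) W) {v : Fin h → ι → ℂ} (hv : ∀ i, v i ≠ 0)
    (hvW : (fun i => Projectivization.mk ℂ (v i) (hv i)) ∈ W) :
    ∃ F : MvPolynomial (Fin h × ι) ℂ, eval (fun p => v p.1 p.2) F ≠ 0 ∧
      ∀ (w : Fin h → ι → ℂ) (hw : ∀ i, w i ≠ 0), eval (fun p => w p.1 p.2) F ≠ 0 →
        (fun i => Projectivization.mk ℂ (w i) (hw i)) ∈ W := by
  rw [isOpen_coinduced] at hW
  obtain ⟨U, hU, hUW⟩ := (@isOpen_induced_iff _ _ (affineZariski (Fin h × ι)) _ _).1 hW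
  have hvU : (fun p : Fin h × ι => v p.1 p.2) ∈ U := by
    have : (⟨v, hv⟩ : {v : Fin h → ι → ℂ // ∀ i, v i ≠ 0}) ∈
      (fun v (p : Fin h × ι) => v.1 p.1 p.2) ⁻¹' U := by rw [hUW]; exact hvW
    exact this
  obtain ⟨F, hF, hF'⟩ := exists_basicOpen hU hvU
  refine ⟨F, hF, fun w hw hwF => ?_⟩
  have : (⟨w, hw⟩ : {v : Fin h → ι → ℂ // ∀ i, v i ≠ 0}) ∈
      (fun v (p : Fin h × ι) => v.1 p.1 p.2) ⁻¹' U := hF' _ hwF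
  rw [hUW] at this
  exact this

theorem isOpen_projZariski_of_eval {ι : Type*} {O : Set (ℙ ℂ (ι → ℂ))} (F : MvPolynomial ι ℂ)
    (hF : ∀ v (hv : v ≠ 0), Projectivization.mk ℂ v hv ∈ O ↔ eval v F ≠ 0) :
    @IsOpen _ (projZariski ι) O := by
  rw [isOpen_coinduced]
  refine (@isOpen_induced_iff _ _ (affineZariski ι) _ _).2 ⟨{v | eval v F ≠ 0}, TopologicalSpace.isOpen_generateFrom_of_mem ⟨F, rfl⟩, ?_⟩
  ext v
  exact (hF v.1 v.2).symm

/-- Every point of a projective space is Zariski closed. -/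
theorem exists_isOpen_projZariski_of_ne {ι : Type*} {x y : ℙ ℂ (ι → ℂ)} (hxy : y ≠ x) :
    ∃ O, @IsOpen _ (projZariski ι) O ∧ y ∈ O ∧ x ∉ O := by
  have key : ∃ a b, y.rep a * x.rep b - y.rep b * x.rep a ≠ 0 := by
    by_contra! H
    apply hxy
    obtain ⟨b, hb⟩ : ∃ b, x.rep b ≠ 0 := Function.ne_iff.1 x.rep_nonzero
    rw [← y.mk_rep, ← x.mk_rep, Projectivization.mk_eq_mk_iff']
    refine ⟨y.rep b / x.rep b, ?_⟩
    ext a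
    have := H a b
    simp only [Pi.smul_apply, smul_eq_mul]
    field_simp
    linear_combination -this
  obtain ⟨a, b, hab⟩ := key
  refine ⟨{z | z.rep a * x.rep b - z.rep b * x.rep a ≠ 0},
    isOpen_projZariski_of_eval (X a * C (x.rep b) - X b * C (x.rep a)) ?_, hab, ?_⟩
  · intro v hv
    obtain ⟨c, hc⟩ := Projectivization.exists_smul_eq_mk_rep ℂ v hv
    simp only [Set.mem_ofPred_eq, ← hc, map_sub, map_mul, eval_X, eval_C, Pi.smul_apply,
      Units.smul_def, smul_eq_mul]
    rw [show (c : ℂ) * v a * x.rep b - c * v b * x.rep a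
      = c * (v a * x.rep b - v b * x.rep a) by ring]
    simp
  · simp [mul_comm]

end ZariskiTopology

/-! ### Isolated zeros -/

section Isolated

variable {σ : Type*} [Fintype σ] [DecidableEq σ]

theorem exists_eval_sub_eq (P : MvPolynomial σ ℂ) (a : σ → ℂ) :
    ∃ m : σ → MvPolynomial σ ℂ, (∀ b, eval a (m b) = eval a (pderiv b P)) ∧
      ∀ t, eval t P - eval a P = ∑ b, eval t (m b) * (t b - a b) := by
  induction P using MvPolynomial.induction_on with
  | C c => exact ⟨0, by simp, by simp⟩
  | add p q hp hq =>
    obtain ⟨m, hm, hm'⟩ := hp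
    obtain ⟨k, hk, hk'⟩ := hq
    refine ⟨m + k, by simp [hm, hk], fun t => ?_⟩
    simp only [map_add, Pi.add_apply, add_mul, Finset.sum_add_distrib, ← hm', ← hk']
    ring
  | mul_X p i hp =>
    obtain ⟨m, hm, hm'⟩ := hp
    refine ⟨fun b => m b * X i + if b = i then C (eval a p) else 0, fun b => ?_, fun t => ?_⟩
    · by_cases h : b = i
      · subst h; simp [hm]; ring
      · simp [hm, h, pderiv_X, Ne.symm h]; ring
    · have h2 : ∀ b, eval t (if b = i then C (eval a p) else 0) * (t b - a b)
          = if b = i then eval a p * (t i - a i) else 0 := by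
        intro b; split_ifs with h <;> simp [h]
      simp only [map_add, map_mul, eval_X, add_mul, Finset.sum_add_distrib, h2]
      rw [Finset.sum_ite_eq' Finset.univ i]
      simp only [Finset.mem_univ, if_true]
      have : ∑ b, eval t (m b) * t i * (t b - a b) = t i * (eval t p - eval a p) := by
        rw [hm', Finset.mul_sum]
        exact Finset.sum_congr rfl fun b _ => by ring
      rw [this]; ring

/-- A common zero of as many polynomials as there are variables, with nonzero Jacobian
determinant, is isolated for the Zariski topology. -/
theorem exists_isolating_polynomial (g : σ → MvPolynomial σ ℂ) (a : σ → ℂ)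
    (ha : ∀ l, eval a (g l) = 0)
    (hJ : (Matrix.of fun l b => eval a (pderiv b (g l))).det ≠ 0) :
    ∃ P : MvPolynomial σ ℂ, eval a P ≠ 0 ∧
      ∀ t, (∀ l, eval t (g l) = 0) → eval t P ≠ 0 → t = a := by
  choose m hm hm' using fun l => exists_eval_sub_eq (g l) a
  have hdet : ∀ t, eval t (Matrix.of m).det = (Matrix.of fun l b => eval t (m l b)).det := by
    intro t
    rw [RingHom.map_det]
    rfl
  -- The equations `g = 0` read `m(t) (t - a) = 0`, and `m(a)` is the Jacobian; wherever `det m(t)`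
  -- is nonzero, only `t = a` remains.
  refine ⟨(Matrix.of m).det, ?_, fun t ht htP => ?_⟩
  · rw [hdet]; simpa [hm] using hJ
  · rw [hdet] at htP
    have : (Matrix.of fun l b => eval t (m l b)).mulVec (t - a) = 0 := by
      ext l
      have := hm' l t
      rw [ht, ha, sub_zero] at this
      simpa [Matrix.mulVec, dotProduct] using this.symm
    exact sub_eq_zero.1 (Matrix.eq_zero_of_mulVec_eq_zero htP this)

/-- Clearing denominators turns a nonvanishing condition in chart coordinates into one in
homogeneous coordinates. -/
theorem exists_eval_div {σ ι : Type*} (P : MvPolynomial σ ℂ) (j : σ → ι) (j₀ : ι) :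
    ∃ (N : ℕ) (Q : MvPolynomial ι ℂ), ∀ v : ι → ℂ, v j₀ ≠ 0 →
      eval v Q = v j₀ ^ N * eval (fun l => v (j l) / v j₀) P := by
  induction P using MvPolynomial.induction_on with
  | C c => exact ⟨0, C c, by simp⟩
  | add p q hp hq =>
    obtain ⟨N, Q, hQ⟩ := hp
    obtain ⟨N', Q', hQ'⟩ := hq
    refine ⟨N + N', X j₀ ^ N' * Q + X j₀ ^ N * Q', fun v hv => ?_⟩
    simp [hQ v hv, hQ' v hv]; ring
  | mul_X p i hp =>
    obtain ⟨N, Q, hQ⟩ := hp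
    refine ⟨N + 1, Q * X (j i), fun v hv => ?_⟩
    simp [hQ v hv]; field_simp; ring

end Isolated

/-! ### Bounds for the dimension -/

theorem mem_homIdeal {ι : Type*} {Y : Set (ℙ ℂ (ι → ℂ))} {F : MvPolynomial ι ℂ} :
    F ∈ homIdeal Y ↔ ∀ v ∈ cone Y, eval v F = 0 := by
  simp [homIdeal, mem_vanishingIdeal_iff]

/-- The image of a finite union of polynomial maps from an affine space has at most the dimension
of that space. -/
theorem trdeg_le_of_cone_subset {ι τ κ : Type} [Fintype τ] [Fintype κ] {Y : Set (ℙ ℂ (ι → ℂ))}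
    (φ : κ → ι → MvPolynomial τ ℂ)
    (hφ : ∀ v ∈ cone Y, ∃ k, ∃ s : τ → ℂ, v = fun a => eval s (φ k a)) :
    Algebra.trdeg ℂ (MvPolynomial ι ℂ ⧸ homIdeal Y) ≤ Fintype.card τ := by
  classical
  refine ciSup_le' fun s => ?_
  by_contra! hlt
  have hle : ((Fintype.card τ + 1 : ℕ) : Cardinal) ≤ Cardinal.mk s.1 := by
    rw [Nat.cast_add, Nat.cast_one]
    exact Cardinal.add_one_le_of_lt hlt
  obtain ⟨emb⟩ : Nonempty (Fin (Fintype.card τ + 1) ↪ s.1) := by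
    rw [← Cardinal.lift_mk_le']
    simpa using hle
  have hind : AlgebraicIndependent ℂ (fun j => (emb j : MvPolynomial ι ℂ ⧸ homIdeal Y)) :=
    AlgebraicIndependent.comp s.2 emb emb.injective
  choose F hF using fun j => Ideal.Quotient.mk_surjective (emb j : MvPolynomial ι ℂ ⧸ homIdeal Y)
  have hdep : ∀ k, ∃ P : MvPolynomial (Fin (Fintype.card τ + 1)) ℂ,
      aeval (fun j => aeval (φ k) (F j)) P = 0 ∧ P ≠ 0 := by
    intro k
    by_contra! H
    have hk : AlgebraicIndependent ℂ (fun j => aeval (φ k) (F j)) :=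
      algebraicIndependent_iff.2 H
    have := hk.cardinalMk_le_trdeg
    rw [MvPolynomial.trdeg_of_isDomain] at this
    simp only [Cardinal.mk_fintype, Fintype.card_fin, Cardinal.lift_natCast] at this
    exact absurd (Nat.cast_le.1 this) (by omega)
  choose P hP hP0 using hdep
  -- Each relation `P k` holds only on the image of `φ k`; their product holds on the whole cone and
  -- is nonzero in a domain.
  have hprod : aeval (fun j => (emb j : MvPolynomial ι ℂ ⧸ homIdeal Y)) (∏ k, P k) = 0 := by
    have h1 : (fun j => (emb j : MvPolynomial ι ℂ ⧸ homIdeal Y)) =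
        fun j => Ideal.Quotient.mkₐ ℂ (homIdeal Y) (F j) := by
      ext j; exact (hF j).symm
    rw [h1, ← MvPolynomial.comp_aeval_apply]
    refine Ideal.Quotient.eq_zero_iff_mem.2 (mem_homIdeal.2 fun v hv => ?_)
    obtain ⟨k, t, rfl⟩ := hφ v hv
    have h2 : ∀ G : MvPolynomial ι ℂ, eval (fun a => eval t (φ k a)) G
        = eval t (aeval (φ k) G) := by
      intro G
      rw [← coe_aeval_eq_eval, ← coe_aeval_eq_eval]
      simp only [RingHom.coe_coe, MvPolynomial.comp_aeval_apply]
    rw [h2, MvPolynomial.comp_aeval_apply, map_prod, Finset.prod_eq_zero (Finset.mem_univ k) (hP k),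
      map_zero]
  have := algebraicIndependent_iff.1 hind _ hprod
  exact Finset.prod_ne_zero_iff.2 (fun k _ => hP0 k) this

theorem projDim_le_of_cone_subset {ι τ κ : Type} [Fintype τ] [Fintype κ] {Y : Set (ℙ ℂ (ι → ℂ))}
    (φ : κ → ι → MvPolynomial τ ℂ)
    (hφ : ∀ v ∈ cone Y, ∃ k, ∃ s : τ → ℂ, v = fun a => eval s (φ k a)) :
    projDim Y ≤ (Fintype.card τ : ℤ) - 1 := by
  have h := Cardinal.toNat_le_toNat (trdeg_le_of_cone_subset φ hφ) (Cardinal.natCast_lt_aleph0)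
  rw [Cardinal.toNat_natCast] at h
  unfold projDim
  omega

theorem le_projDim_of_algebraicIndependent {ι ρ : Type} [Fintype ι] [Fintype ρ]
    {Y : Set (ℙ ℂ (ι → ℂ))} (F : ρ → MvPolynomial ι ℂ)
    (hF : ∀ P : MvPolynomial ρ ℂ, (∀ v ∈ cone Y, eval (fun j => eval v (F j)) P = 0) → P = 0) :
    (Fintype.card ρ : ℤ) - 1 ≤ projDim Y := by
  -- `Cardinal.toNat` sends infinite cardinals to `0`, so a lower bound for `projDim` needs
  -- finiteness of the transcendence degree.
  have hfin : Algebra.trdeg ℂ (MvPolynomial ι ℂ ⧸ homIdeal Y) ≤ Fintype.card ι :=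
    trdeg_le_of_cone_subset (fun _ : Unit => X) fun v _ => ⟨(), v, by simp⟩
  have hind : AlgebraicIndependent ℂ fun j => Ideal.Quotient.mkₐ ℂ (homIdeal Y) (F j) := by
    refine algebraicIndependent_iff.2 fun P hP => hF P fun v hv => ?_
    rw [← MvPolynomial.comp_aeval_apply] at hP
    have := mem_homIdeal.1 (Ideal.Quotient.eq_zero_iff_mem.1 hP) v hv
    rw [← coe_aeval_eq_eval] at this ⊢
    simpa only [RingHom.coe_coe, MvPolynomial.comp_aeval_apply, ← coe_aeval_eq_eval] using this
  have h := Cardinal.toNat_le_toNat hind.cardinalMk_le_trdeg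
    (hfin.trans_lt Cardinal.natCast_lt_aleph0)
  simp only [Cardinal.mk_fintype, Cardinal.toNat_natCast] at h
  unfold projDim
  omega

theorem projDim_nonpos_of_subset_range {ι : Type} {h : ℕ} {Y : Set (ℙ ℂ (ι → ℂ))}
    (x : Fin h → ℙ ℂ (ι → ℂ)) (hY : Y ⊆ Set.range x) : projDim Y ≤ 0 := by
  have := projDim_le_of_cone_subset (Y := Y) (τ := Unit)
    (fun i a => C ((x i).rep a) * X ()) (by
      rintro v ⟨hv, hvY⟩
      obtain ⟨i, hi⟩ := hY hvY
      have h2 := hi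
      rw [← (x i).mk_rep, Projectivization.mk_eq_mk_iff] at h2
      obtain ⟨c, hc⟩ := h2
      refine ⟨i, fun _ => ((c⁻¹ : ℂˣ) : ℂ), ?_⟩
      ext a
      rw [← hc]
      simp [Units.smul_def, mul_comm])
  simpa using this

/-! ### The standard chart of a Segre-Veronese variety -/

section Chart

variable {r : ℕ} (n d : Fin r → ℕ)

/-- The coordinates of the standard affine chart of `ℙ^{n₁} × ⋯ × ℙ^{n_r}`. -/
abbrev ChartIndex : Type := (k : Fin r) × Fin (n k)

variable {n d}

/-- The monomial of index `J`, evaluated in a commutative ring. -/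
def monomialEval {R : Type*} [CommRing R] (x : (k : Fin r) → Fin (n k + 1) → R)
    (J : MonomialIndex n d) : R :=
  ∏ k, ((J k : Multiset (Fin (n k + 1))).map (x k)).prod

theorem map_monomialEval {R S : Type*} [CommRing R] [CommRing S] (f : R →+* S)
    (x : (k : Fin r) → Fin (n k + 1) → R) (J : MonomialIndex n d) :
    f (monomialEval x J) = monomialEval (fun k b => f (x k b)) J := by
  simp only [monomialEval, map_prod, map_multiset_prod, Multiset.map_map]
  rfl

theorem monomialEval_smul {R : Type*} [CommRing R] (c : Fin r → R)
    (x : (k : Fin r) → Fin (n k + 1) → R) (J : MonomialIndex n d) :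
    monomialEval (fun k b => c k * x k b) J = (∏ k, c k ^ d k) * monomialEval x J := by
  simp only [monomialEval, ← Finset.prod_mul_distrib]
  refine Finset.prod_congr rfl fun k _ => ?_
  rw [Multiset.prod_map_mul, Multiset.map_const', Multiset.prod_replicate]
  congr 2
  exact (J k).2

theorem monomialMap_eq (x : (k : Fin r) → Fin (n k + 1) → ℂ) :
    monomialMap n d x = monomialEval x := rfl

/-- The point of the standard chart with coordinates `t`. -/
def chartPoint {R : Type*} [CommRing R] (t : ChartIndex n → R) (k : Fin r) : Fin (n k + 1) → R :=
  Fin.cons 1 fun b => t ⟨k, b⟩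

theorem map_chartPoint {R S : Type*} [CommRing R] [CommRing S] (f : R →+* S)
    (t : ChartIndex n → R) (k : Fin r) (b : Fin (n k + 1)) :
    f (chartPoint t k b) = chartPoint (fun l => f (t l)) k b := by
  refine Fin.cases ?_ (fun b => ?_) b <;> simp [chartPoint]

/-- The restriction of a coordinate function to the standard chart. -/
def chartMonomial (J : MonomialIndex n d) : MvPolynomial (ChartIndex n) ℂ :=
  monomialEval (chartPoint X) J

theorem eval_chartMonomial (t : ChartIndex n → ℂ) (J : MonomialIndex n d) :
    eval t (chartMonomial J) = monomialMap n d (chartPoint t) J := by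
  rw [chartMonomial, map_monomialEval, monomialMap_eq]
  simp only [map_chartPoint, eval_X]

/-- The restriction to the standard chart of the linear form with coefficients `H`. -/
def chartForm : (MonomialIndex n d → ℂ) →ₗ[ℂ] MvPolynomial (ChartIndex n) ℂ :=
  Fintype.linearCombination ℂ chartMonomial

theorem chartForm_apply (H : MonomialIndex n d → ℂ) :
    chartForm H = ∑ J, H J • chartMonomial J := rfl

/-- The index of the monomial that is constant on the standard chart. -/
def baseIndex : MonomialIndex n d := fun k => Sym.replicate (d k) 0

/-- The index of the monomial that restricts to the `b`-th homogeneous coordinate of the `k`-th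
factor on the standard chart. -/
def coordIndex (hd : ∀ k, 1 ≤ d k) (k : Fin r) (b : Fin (n k + 1)) : MonomialIndex n d :=
  Function.update baseIndex k
    (Sym.mk (b ::ₘ Multiset.replicate (d k - 1) 0) (by have := hd k; simp; omega))

theorem coordIndex_zero (hd : ∀ k, 1 ≤ d k) (k : Fin r) :
    (coordIndex hd k 0 : MonomialIndex n d) = baseIndex := by
  rw [coordIndex, Function.update_eq_self_iff]
  apply Subtype.ext
  have : d k = (d k - 1) + 1 := by have := hd k; omega
  change _ = Multiset.replicate (d k) 0
  conv_rhs => rw [this]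
  rw [Multiset.replicate_succ]

theorem monomialEval_baseIndex {R : Type*} [CommRing R] (x : (k : Fin r) → Fin (n k + 1) → R) :
    monomialEval x (baseIndex : MonomialIndex n d) = ∏ k, x k 0 ^ d k := by
  refine Finset.prod_congr rfl fun k _ => ?_
  change (Multiset.map (x k) (Multiset.replicate (d k) 0)).prod = _
  simp

theorem monomialEval_chartPoint_baseIndex {R : Type*} [CommRing R] (t : ChartIndex n → R) :
    monomialEval (chartPoint t) (baseIndex : MonomialIndex n d) = 1 := by
  simp [monomialEval_baseIndex, chartPoint]

theorem monomialEval_chartPoint_coordIndex {R : Type*} [CommRing R] (hd : ∀ k, 1 ≤ d k)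
    (t : ChartIndex n → R) (k : Fin r) (b : Fin (n k + 1)) :
    monomialEval (chartPoint t) (coordIndex hd k b : MonomialIndex n d) = chartPoint t k b := by
  rw [monomialEval, Finset.prod_eq_single k]
  · simp [coordIndex, chartPoint]
  · intro j _ hj
    rw [coordIndex, Function.update_of_ne hj]
    change (Multiset.map _ (Multiset.replicate (d j) 0)).prod = 1
    simp [chartPoint]
  · simp

theorem monomialMap_chartPoint_ne_zero (t : ChartIndex n → ℂ) :
    monomialMap n d (chartPoint t) ≠ 0 := by
  intro h
  have := congrFun h baseIndex
  rw [monomialMap_eq, monomialEval_chartPoint_baseIndex] at this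
  exact one_ne_zero this

/-- The point of the Segre-Veronese variety with chart coordinates `t`. -/
def chartImage (t : ChartIndex n → ℂ) : ℙ ℂ (MonomialIndex n d → ℂ) :=
  Projectivization.mk ℂ _ (monomialMap_chartPoint_ne_zero t)

theorem chartPoint_ne_zero (t : ChartIndex n → ℂ) (k : Fin r) : chartPoint t k ≠ 0 := by
  intro h
  simpa [chartPoint] using congrFun h 0

theorem chartImage_mem (t : ChartIndex n → ℂ) :
    (chartImage t : ℙ ℂ (MonomialIndex n d → ℂ)) ∈ segreVeronese n d :=
  ⟨chartPoint t, chartPoint_ne_zero t, monomialMap_chartPoint_ne_zero t, rfl⟩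

theorem smul_mem_cone {ι : Type*} {Y : Set (ℙ ℂ (ι → ℂ))} {v : ι → ℂ} (hv : v ∈ cone Y) {c : ℂ}
    (hc : c ≠ 0) : c • v ∈ cone Y := by
  obtain ⟨hv0, hvY⟩ := hv
  refine ⟨smul_ne_zero hc hv0, ?_⟩
  convert hvY using 1
  rw [Projectivization.mk_eq_mk_iff']
  exact ⟨c, rfl⟩

theorem monomialMap_chartPoint_mem_cone (t : ChartIndex n → ℂ) :
    monomialMap n d (chartPoint t) ∈ cone (segreVeronese n d) :=
  ⟨monomialMap_chartPoint_ne_zero t, chartImage_mem t⟩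

theorem monomialMap_eq_smul (x : (k : Fin r) → Fin (n k + 1) → ℂ) (hx : ∀ k, x k 0 ≠ 0) :
    monomialMap n d x
      = (∏ k, x k 0 ^ d k) • monomialMap n d (chartPoint fun l => x l.1 l.2.succ / x l.1 0) := by
  ext J
  simp only [Pi.smul_apply, smul_eq_mul, monomialMap_eq]
  rw [← monomialEval_smul]
  congr 1
  ext k b
  refine Fin.cases ?_ (fun b => ?_) b
  · simp [chartPoint]
  · have := hx k
    simp [chartPoint]
    field_simp

theorem exists_eq_monomialMap_of_mem_cone {v : MonomialIndex n d → ℂ}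
    (hv : v ∈ cone (segreVeronese n d)) :
    ∃ (c : ℂ) (x : (k : Fin r) → Fin (n k + 1) → ℂ), c ≠ 0 ∧ (∀ k, x k ≠ 0) ∧
      v = c • monomialMap n d x := by
  obtain ⟨hv0, x, hx, hx0, he⟩ := hv
  rw [Projectivization.mk_eq_mk_iff] at he
  obtain ⟨c, hc⟩ := he
  exact ⟨c, x, c.ne_zero, hx, hc.symm⟩

/-- The chart is inverted by ratios of coordinates: on it the monomial `baseIndex` is `1` and the
monomials `coordIndex` are the affine coordinates. -/
theorem exists_chart_of_mem_cone (hd : ∀ k, 1 ≤ d k) {v : MonomialIndex n d → ℂ}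
    (hv : v ∈ cone (segreVeronese n d)) (h0 : v baseIndex ≠ 0) :
    v = v baseIndex • monomialMap n d
      (chartPoint fun l => v (coordIndex hd l.1 l.2.succ) / v baseIndex) := by
  obtain ⟨c, x, hc, hx, rfl⟩ := exists_eq_monomialMap_of_mem_cone hv
  have hx0 : ∀ k, x k 0 ≠ 0 := by
    intro k hk
    apply h0
    simp only [Pi.smul_apply, monomialMap_eq, monomialEval_baseIndex]
    rw [Finset.prod_eq_zero (Finset.mem_univ k), smul_zero]
    rw [hk, zero_pow (by have := hd k; omega)]
  rw [monomialMap_eq_smul x hx0, smul_smul]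
  rw [monomialMap_eq_smul x hx0, smul_smul] at h0
  set e := c * ∏ k, x k 0 ^ d k
  have h1 : (e • monomialMap n d (chartPoint fun l => x l.1 l.2.succ / x l.1 0)) baseIndex
      = e := by
    simp [monomialMap_eq, monomialEval_chartPoint_baseIndex]
  rw [h1] at h0 ⊢
  congr 3
  ext l
  simp only [Pi.smul_apply, smul_eq_mul, monomialMap_eq, monomialEval_chartPoint_coordIndex]
  simp only [chartPoint, Fin.cons_succ]
  field_simp

end Chart

/-! ### Tangent spaces and tangency in chart coordinates. -/

section Tangent

variable {r : ℕ} {n d : Fin r → ℕ}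

/-- Finitely many charts, one for each choice of a nonvanishing coordinate in every factor, cover
the cone; the variable `none` is the scale. Only this upper bound on the dimension is needed for
nondefectivity. -/
theorem projDim_segreVeronese_le :
    projDim (segreVeronese n d) ≤ Fintype.card (ChartIndex n) := by
  have := projDim_le_of_cone_subset (Y := segreVeronese n d) (τ := Option (ChartIndex n))
    (κ := (k : Fin r) → Fin (n k + 1))
    (fun a J => X none * monomialEval
      (fun k => (Fin.insertNth (a k) 1 fun b => X (some ⟨k, b⟩) :
        Fin (n k + 1) → MvPolynomial (Option (ChartIndex n)) ℂ)) J) (by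
      intro v hv
      obtain ⟨c, x, hc, hx, rfl⟩ := exists_eq_monomialMap_of_mem_cone hv
      choose a ha using fun k => Function.ne_iff.1 (hx k)
      refine ⟨a, fun o => o.elim (c * ∏ k, x k (a k) ^ d k)
        fun l => x l.1 ((a l.1).succAbove l.2) / x l.1 (a l.1), ?_⟩
      ext J
      simp only [map_mul, eval_X, map_monomialEval, Option.elim, Pi.smul_apply, smul_eq_mul,
        mul_assoc, monomialMap_eq]
      rw [← monomialEval_smul]
      congr 2
      ext k b
      have hk := ha k
      simp only [Pi.zero_apply] at hk
      refine Fin.succAboveCases (a k) ?_ (fun b => ?_) b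
      · simp
      · simp
        field_simp)
  simpa using this

theorem exists_smul_eq_rep_chartImage (t : ChartIndex n → ℂ) :
    ∃ c : ℂ, c ≠ 0 ∧ (chartImage t : ℙ ℂ (MonomialIndex n d → ℂ)).rep
      = c • monomialMap n d (chartPoint t) := by
  obtain ⟨c, hc⟩ := Projectivization.exists_smul_eq_mk_rep ℂ _
    (monomialMap_chartPoint_ne_zero (d := d) t)
  exact ⟨c, c.ne_zero, hc.symm⟩

theorem eval_chartForm (t : ChartIndex n → ℂ) (H : MonomialIndex n d → ℂ) :
    eval t (chartForm H) = H ⬝ᵥ monomialMap n d (chartPoint t) := by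
  simp [chartForm_apply, dotProduct, smul_eval, eval_chartMonomial]

theorem eval_pderiv_chartForm (t : ChartIndex n → ℂ) (H : MonomialIndex n d → ℂ)
    (l : ChartIndex n) :
    eval t (pderiv l (chartForm H)) = H ⬝ᵥ fun J => eval t (pderiv l (chartMonomial J)) := by
  simp [chartForm_apply, dotProduct, smul_eval]

theorem monomialMap_mem_tangentSpace (t : ChartIndex n → ℂ) :
    monomialMap n d (chartPoint t) ∈ tangentSpace (segreVeronese n d) (chartImage t) := by
  obtain ⟨c, hc, hrep⟩ := exists_smul_eq_rep_chartImage (d := d) t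
  intro F hF
  rw [hrep]
  -- Scaling by `exp s` keeps the curve in the cone, which omits the vertex.
  have h1 := hasDerivAt_eval F (s := 0)
    (γ := fun s => Complex.exp s • c • monomialMap n d (chartPoint t))
    (γ' := c • monomialMap n d (chartPoint t)) (by
      intro a
      simpa using (Complex.hasDerivAt_exp 0).mul_const ((c • monomialMap n d (chartPoint t)) a))
  have h2 : (fun s => eval (Complex.exp s • c • monomialMap n d (chartPoint t)) F)
      = fun _ => 0 := by
    ext s
    exact mem_homIdeal.1 hF _ (smul_mem_cone (smul_mem_cone (monomialMap_chartPoint_mem_cone t) hc)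
      (Complex.exp_ne_zero s))
  rw [h2] at h1
  have h3 := h1.unique (hasDerivAt_const (0 : ℂ) (0 : ℂ))
  simp only [Complex.exp_zero, one_smul] at h3
  simp only [Pi.smul_apply, smul_eq_mul, mul_left_comm _ c, ← Finset.mul_sum] at h3
  exact (mul_eq_zero.1 h3).resolve_left hc

theorem pderiv_mem_tangentSpace (t : ChartIndex n → ℂ) (l : ChartIndex n) :
    (fun J => eval t (pderiv l (chartMonomial J))) ∈
      tangentSpace (segreVeronese n d) (chartImage t) := by
  classical
  obtain ⟨c, hc, hrep⟩ := exists_smul_eq_rep_chartImage (d := d) t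
  intro F hF
  rw [hrep]
  have h1 := hasDerivAt_eval F (s := 0)
    (γ := fun s => c • monomialMap n d (chartPoint (t + s • Pi.single l 1)))
    (γ' := fun J => c * eval t (pderiv l (chartMonomial J))) (by
      intro J
      simp only [Pi.smul_apply, smul_eq_mul, ← eval_chartMonomial]
      refine HasDerivAt.const_mul c ?_
      have := hasDerivAt_eval (chartMonomial J) (s := 0) (γ := fun s => t + s • Pi.single l 1)
        (γ' := Pi.single l 1) (by
          intro a
          simpa using ((hasDerivAt_id (0 : ℂ)).mul_const
            ((Pi.single l 1 : ChartIndex n → ℂ) a)).const_add (t a))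
      simpa [Pi.single_apply] using this)
  have h2 : (fun s : ℂ => eval (c • monomialMap n d (chartPoint (t + s • Pi.single l 1))) F)
      = fun _ => 0 := by
    ext s
    exact mem_homIdeal.1 hF _ (smul_mem_cone (monomialMap_chartPoint_mem_cone _) hc)
  rw [h2] at h1
  have h3 := h1.unique (hasDerivAt_const (0 : ℂ) (0 : ℂ))
  simp only [zero_smul, add_zero, mul_left_comm _ c, ← Finset.mul_sum] at h3
  exact (mul_eq_zero.1 h3).resolve_left hc

/-- An equation of the Segre-Veronese variety that expresses the coordinate of index `K` on the
standard chart. -/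
def chartEquation (hd : ∀ k, 1 ≤ d k) (K : MonomialIndex n d) :
    MvPolynomial (MonomialIndex n d) ℂ :=
  X baseIndex * (X K * X baseIndex ^ (∑ k, d k)
    - X baseIndex * monomialEval (fun k b => X (coordIndex hd k b)) K)

theorem eval_chartEquation (hd : ∀ k, 1 ≤ d k) (K : MonomialIndex n d)
    {v : MonomialIndex n d → ℂ} (hv : v baseIndex ≠ 0) :
    eval v (chartEquation hd K) = v baseIndex ^ (∑ k, d k + 1) * (v K - v baseIndex *
      eval (fun l => v (coordIndex hd l.1 l.2.succ) / v baseIndex) (chartMonomial K)) := by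
  have h1 : monomialEval (fun k b => v (coordIndex hd k b)) K = v baseIndex ^ (∑ k, d k) *
      eval (fun l => v (coordIndex hd l.1 l.2.succ) / v baseIndex) (chartMonomial K) := by
    rw [eval_chartMonomial, monomialMap_eq, ← Finset.prod_pow_eq_pow_sum, ← monomialEval_smul]
    congr 1
    ext k b
    refine Fin.cases ?_ (fun b => ?_) b
    · simp [chartPoint, coordIndex_zero]
    · simp [chartPoint]
      field_simp
  simp only [chartEquation, map_mul, map_sub, map_pow, eval_X, map_monomialEval, h1]
  ring

theorem chartEquation_mem (hd : ∀ k, 1 ≤ d k) (K : MonomialIndex n d) :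
    chartEquation hd K ∈ homIdeal (segreVeronese n d) := by
  refine mem_homIdeal.2 fun v hv => ?_
  by_cases h0 : v baseIndex = 0
  -- The outer factor `X baseIndex` of the equation takes care of the points off the chart.
  · simp [chartEquation, h0]
  · rw [eval_chartEquation hd K h0, eval_chartMonomial]
    have := congrFun (exists_chart_of_mem_cone hd hv h0) K
    rw [Pi.smul_apply, smul_eq_mul] at this
    rw [← this, sub_self, mul_zero]

/-- The tangent space is spanned by the point and the partial derivatives of the
parametrization. -/
theorem exists_of_mem_tangentSpace (hd : ∀ k, 1 ≤ d k) (t : ChartIndex n → ℂ)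
    {w : MonomialIndex n d → ℂ} (hw : w ∈ tangentSpace (segreVeronese n d) (chartImage t)) :
    ∃ (α : ℂ) (β : ChartIndex n → ℂ), ∀ J, w J = α * eval t (chartMonomial J)
      + ∑ l, eval t (pderiv l (chartMonomial J)) * β l := by
  obtain ⟨c, hc, hrep⟩ := exists_smul_eq_rep_chartImage (d := d) t
  set φ := monomialMap n d (chartPoint t) with hφ
  have hφ0 : φ baseIndex = 1 := by rw [hφ, monomialMap_eq, monomialEval_chartPoint_baseIndex]
  -- The line `Z` need not stay in the cone, but since `w` is tangent the equations vanish along it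
  -- to first order. Differentiating their form from `eval_chartEquation`, with `u` the ratios of
  -- coordinates of `Z`, expresses `w` by the point and the partial derivatives.
  let Z : ℂ → MonomialIndex n d → ℂ := fun s => c • φ + s • w
  have hZ : ∀ J, HasDerivAt (fun s => Z s J) (w J) 0 := by
    intro J
    simpa [Z] using ((hasDerivAt_id (0 : ℂ)).mul_const (w J)).const_add (c * φ J)
  have hZ0 : Z 0 baseIndex = c := by simp [Z, hφ0]
  let u : ℂ → ChartIndex n → ℂ := fun s l => Z s (coordIndex hd l.1 l.2.succ) / Z s baseIndex
  have hu0 : u 0 = t := by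
    ext l
    simp only [u, hZ0]
    simp only [Z, zero_smul, add_zero, Pi.smul_apply, smul_eq_mul, hφ, monomialMap_eq,
      monomialEval_chartPoint_coordIndex]
    simp only [chartPoint, Fin.cons_succ]
    field_simp
  have hu : ∀ l, ∃ u' : ℂ, HasDerivAt (fun s => u s l) u' 0 := fun l =>
    ⟨_, (hZ _).fun_div (hZ _) (by rw [hZ0]; exact hc)⟩
  choose u' hu' using hu
  refine ⟨w baseIndex, fun l => c * u' l, fun K => ?_⟩
  have hψ := (hZ baseIndex).fun_mul (hasDerivAt_eval (chartMonomial K) (s := 0) hu')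
  have hdiff := (hZ K).fun_sub hψ
  have hprod := ((hZ baseIndex).fun_pow (∑ k, d k + 1)).fun_mul hdiff
  have heq : (fun s => eval (Z s) (chartEquation hd K)) =ᶠ[𝓝 0]
      fun s => Z s baseIndex ^ (∑ k, d k + 1) *
        (Z s K - Z s baseIndex * eval (u s) (chartMonomial K)) := by
    have hne : ∀ᶠ s in 𝓝 0, Z s baseIndex ≠ 0 :=
      (hZ baseIndex).continuousAt.eventually_ne (by rw [hZ0]; exact hc)
    filter_upwards [hne] with s hs
    exact eval_chartEquation hd K hs
  have h1 := (hasDerivAt_eval (chartEquation hd K) (s := 0) hZ).unique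
    (hprod.congr_of_eventuallyEq heq)
  have h2 := hw _ (chartEquation_mem hd K)
  have hZrep : Z 0 = (chartImage t : ℙ ℂ (MonomialIndex n d → ℂ)).rep := by
    rw [hrep]; simp [Z]
  rw [← hZrep] at h2
  rw [h2, hu0, hZ0] at h1
  have hK : Z 0 K - c * eval t (chartMonomial K) = 0 := by
    simp [Z, eval_chartMonomial, hφ]
  rw [hK, mul_zero, zero_add] at h1
  have h3 := (mul_eq_zero.1 h1.symm).resolve_left (pow_ne_zero _ hc)
  rw [sub_eq_zero.1 h3, Finset.mul_sum]
  congr 1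
  exact Finset.sum_congr rfl fun l _ => by ring

/-- `P` is singular at `t`. -/
def SingularAt {σ : Type*} (P : MvPolynomial σ ℂ) (t : σ → ℂ) : Prop :=
  eval t P = 0 ∧ ∀ l, eval t (pderiv l P) = 0

theorem tangentSpace_le_hyperplane_iff (hd : ∀ k, 1 ≤ d k) (t : ChartIndex n → ℂ)
    (H : ℙ ℂ (MonomialIndex n d → ℂ)) :
    tangentSpace (segreVeronese n d) (chartImage t) ≤ hyperplane H ↔
      SingularAt (chartForm H.rep) t := by
  constructor
  · intro h
    refine ⟨?_, fun l => ?_⟩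
    · rw [eval_chartForm]
      exact h (monomialMap_mem_tangentSpace t)
    · rw [eval_pderiv_chartForm]
      exact h (pderiv_mem_tangentSpace t l)
  · rintro ⟨h0, h1⟩ w hw
    obtain ⟨α, β, hw⟩ := exists_of_mem_tangentSpace hd t hw
    change H.rep ⬝ᵥ w = 0
    have hwe : w = α • monomialMap n d (chartPoint t)
        + ∑ l, β l • fun J => eval t (pderiv l (chartMonomial J)) := by
      ext J
      simp only [hw, Pi.add_apply, Pi.smul_apply, Finset.sum_apply, smul_eq_mul,
        eval_chartMonomial, mul_comm]
    rw [hwe, dotProduct_add, dotProduct_smul, dotProduct_sum, ← eval_chartForm, h0, smul_zero,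
      zero_add]
    refine Finset.sum_eq_zero fun l _ => ?_
    rw [dotProduct_smul, ← eval_pderiv_chartForm, h1, smul_zero]

/-- The Hessian matrix of `P` at `t`. -/
def hessian {σ : Type*} (P : MvPolynomial σ ℂ) (t : σ → ℂ) : Matrix σ σ ℂ :=
  Matrix.of fun l b => eval t (pderiv b (pderiv l P))

theorem exists_eq_chartImage (hd : ∀ k, 1 ≤ d k) {y : ℙ ℂ (MonomialIndex n d → ℂ)}
    (hy : y ∈ segreVeronese n d) (h0 : y.rep baseIndex ≠ 0) :
    y = chartImage fun l => y.rep (coordIndex hd l.1 l.2.succ) / y.rep baseIndex := by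
  have hcone : y.rep ∈ cone (segreVeronese n d) := ⟨y.rep_nonzero, by rwa [y.mk_rep]⟩
  have := exists_chart_of_mem_cone hd hcone h0
  conv_lhs => rw [← y.mk_rep]
  rw [chartImage, Projectivization.mk_eq_mk_iff']
  exact ⟨_, this.symm⟩

/-- A point at which the hyperplane section has a nondegenerate Hessian is an isolated point of
the tangency locus. -/
theorem isComponent_subset_singleton [DecidableEq (ChartIndex n)] (hd : ∀ k, 1 ≤ d k)
    (t : ChartIndex n → ℂ) {H : ℙ ℂ (MonomialIndex n d → ℂ)} (hsing : SingularAt (chartForm H.rep) t)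
    (hess : (hessian (chartForm H.rep) t).det ≠ 0) {Z : Set (ℙ ℂ (MonomialIndex n d → ℂ))}
    (hZ : IsComponent Z (tangencyLocus (segreVeronese n d) H)) (hmem : chartImage t ∈ Z) :
    Z ⊆ {chartImage t} := by
  obtain ⟨P, hPt, hP⟩ := exists_isolating_polynomial (fun l => pderiv l (chartForm H.rep)) t
    hsing.2 hess
  obtain ⟨N, Q, hQ⟩ := exists_eval_div P
    (fun l => (coordIndex hd l.1 l.2.succ : MonomialIndex n d)) baseIndex
  intro z hz
  by_contra hne
  obtain ⟨O', hO', hzO', hxO'⟩ := exists_isOpen_projZariski_of_ne hne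
  let O : Set (ℙ ℂ (MonomialIndex n d → ℂ)) := {y | y.rep baseIndex ≠ 0 ∧
    eval (fun l => y.rep (coordIndex hd l.1 l.2.succ) / y.rep baseIndex) P ≠ 0}
  have hratio : ∀ {v : MonomialIndex n d → ℂ} {c : ℂ}, c ≠ 0 →
      (fun l : ChartIndex n => (c • v) (coordIndex hd l.1 l.2.succ) / (c • v) baseIndex)
        = fun l => v (coordIndex hd l.1 l.2.succ) / v baseIndex := by
    intro v c hc
    ext l
    simp only [Pi.smul_apply, smul_eq_mul]
    rw [mul_div_mul_left _ _ hc]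
  have hO : @IsOpen _ (projZariski _) O := by
    refine isOpen_projZariski_of_eval (X baseIndex * Q) fun v hv => ?_
    obtain ⟨c, hc⟩ := Projectivization.exists_smul_eq_mk_rep ℂ v hv
    rw [Units.smul_def] at hc
    simp only [O, Set.mem_ofPred_eq, ← hc, hratio c.ne_zero]
    simp only [Pi.smul_apply, smul_eq_mul, map_mul, eval_X, ne_eq, mul_eq_zero, c.ne_zero,
      false_or, not_or]
    refine and_congr_right fun h0 => ?_
    rw [hQ v h0]
    simp [h0]
  have hxO : chartImage t ∈ O := by
    obtain ⟨c, hc, hrep⟩ := exists_smul_eq_rep_chartImage (d := d) t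
    simp only [O, Set.mem_ofPred_eq, hrep, hratio hc]
    simp only [monomialMap_eq, Pi.smul_apply, monomialEval_chartPoint_baseIndex,
      monomialEval_chartPoint_coordIndex]
    simpa [chartPoint, hc] using hPt
  -- Irreducibility of `Z` yields a point in both open sets; inside `O` the only tangency point is
  -- `chartImage t`, which `O'` excludes.
  obtain ⟨y, hyZ, hyO, hyO'⟩ := hZ.1.1.2 O O' hO hO' ⟨_, hmem, hxO⟩ ⟨z, hz, hzO'⟩
  obtain ⟨hyX, hyT⟩ := hZ.1.2 hyZ
  have hy := exists_eq_chartImage hd hyX hyO.1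
  rw [hy, tangentSpace_le_hyperplane_iff hd] at hyT
  have := hP _ hyT.2 hyO.2
  rw [this] at hy
  exact hxO' (hy ▸ hyO')

end Tangent

/-! ### From a special tuple of points to general tuples; Terracini's argument. -/

section Generic

variable {r : ℕ} {n d : Fin r → ℕ} {h : ℕ}

/-- The matrix of the linear map that takes a linear form to the `1`-jets at the points `t i` of
its restriction to the chart. -/
def jetMatrix (d : Fin r → ℕ) (t : Fin h → ChartIndex n → ℂ) :
    Matrix (Fin h × Option (ChartIndex n)) (MonomialIndex n d) ℂ :=
  Matrix.of fun p J => p.2.elim (eval (t p.1) (chartMonomial J))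
    fun l => eval (t p.1) (pderiv l (chartMonomial J))

theorem jetMatrix_mulVec_none (t : Fin h → ChartIndex n → ℂ) (H : MonomialIndex n d → ℂ)
    (i : Fin h) : (jetMatrix d t).mulVec H (i, none) = eval (t i) (chartForm H) := by
  simp [jetMatrix, Matrix.mulVec, chartForm_apply, dotProduct, smul_eval, mul_comm]

theorem jetMatrix_mulVec_some (t : Fin h → ChartIndex n → ℂ) (H : MonomialIndex n d → ℂ)
    (i : Fin h) (l : ChartIndex n) :
    (jetMatrix d t).mulVec H (i, some l) = eval (t i) (pderiv l (chartForm H)) := by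
  simp [jetMatrix, Matrix.mulVec, chartForm_apply, dotProduct, smul_eval, mul_comm]

theorem jetMatrix_mulVec_eq_zero_iff (t : Fin h → ChartIndex n → ℂ) (H : MonomialIndex n d → ℂ) :
    (jetMatrix d t).mulVec H = 0 ↔ ∀ i, SingularAt (chartForm H) (t i) := by
  constructor
  · intro H0 i
    refine ⟨?_, fun l => ?_⟩
    · rw [← jetMatrix_mulVec_none, H0, Pi.zero_apply]
    · rw [← jetMatrix_mulVec_some, H0, Pi.zero_apply]
  · intro H0
    ext ⟨i, o⟩
    cases o with
    | none => rw [jetMatrix_mulVec_none, (H0 i).1, Pi.zero_apply]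
    | some l => rw [jetMatrix_mulVec_some, (H0 i).2, Pi.zero_apply]

theorem differentiable_eval_apply (P : MvPolynomial (ChartIndex n) ℂ) (i : Fin h) :
    Differentiable ℂ fun t : Fin h → ChartIndex n → ℂ => eval (t i) P :=
  (differentiable_eval P).comp (differentiable_apply i)

theorem differentiable_jetMatrix (p : Fin h × Option (ChartIndex n)) (J : MonomialIndex n d) :
    Differentiable ℂ fun t : Fin h → ChartIndex n → ℂ => jetMatrix d t p J := by
  obtain ⟨i, o⟩ := p
  cases o with
  | none => exact differentiable_eval_apply _ i
  | some l => exact differentiable_eval_apply _ i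

theorem hessian_chartForm_apply (H : MonomialIndex n d → ℂ) (t : ChartIndex n → ℂ)
    (l b : ChartIndex n) : hessian (chartForm H) t l b
      = ∑ J, H J * eval t (pderiv b (pderiv l (chartMonomial J))) := by
  simp [hessian, chartForm_apply, smul_eval]

/-- The linear forms whose restriction to the chart is singular at the points `t i`. -/
def singularForms (d : Fin r → ℕ) (t : Fin h → ChartIndex n → ℂ) :
    Submodule ℂ (MonomialIndex n d → ℂ) :=
  LinearMap.ker (jetMatrix d t).mulVecLin

theorem mem_singularForms {t : Fin h → ChartIndex n → ℂ} {H : MonomialIndex n d → ℂ} :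
    H ∈ singularForms d t ↔ ∀ i, SingularAt (chartForm H) (t i) := by
  rw [← jetMatrix_mulVec_eq_zero_iff]
  rfl

/-- If the `1`-jets at some `h`-tuple of points are independent and singular forms with a
nondegenerate Hessian exist there, then the latter exist at a general `h`-tuple. -/
theorem exists_nondegenerate_of_special (t₀ : Fin h → ChartIndex n → ℂ)
    (hjet : Function.Surjective (jetMatrix d t₀).mulVec)
    (hess : ∀ i, ∃ H ∈ singularForms d t₀, (hessian (chartForm H) (t₀ i)).det ≠ 0)
    {f : (Fin h → ChartIndex n → ℂ) → ℂ} (hf : Differentiable ℂ f) (hf0 : ∃ t, f t ≠ 0) :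
    ∃ t, f t ≠ 0 ∧ ∀ i, ∃ H ∈ singularForms d t, (hessian (chartForm H) (t i)).det ≠ 0 := by
  classical
  choose H₀ hH₀ hess₀ using hess
  choose B' hB' using fun p => hjet (Pi.single p 1)
  let B : Matrix (MonomialIndex n d) (Fin h × Option (ChartIndex n)) ℂ := Matrix.of fun J p => B' p J
  have hB : jetMatrix d t₀ * B = 1 := by
    ext p q
    have := congrFun (hB' q) p
    rw [Matrix.mul_apply, Matrix.one_apply]
    simpa [Matrix.mulVec, dotProduct, B, Pi.single_apply] using this
  have hMB : ∀ p q, Differentiable ℂ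
      fun t : Fin h → ChartIndex n → ℂ => (jetMatrix d t * B) p q := by
    intro p q
    simp only [Matrix.mul_apply]
    exact Differentiable.fun_sum fun J _ => (differentiable_jetMatrix p J).mul_const _
  -- Cramer's rule, with `M = jetMatrix d t`: since `M B · adj(M B) = det(M B)`, the matrix `M`
  -- kills this form for every `t`. It is polynomial in `t` and equals `H₀ i` at `t₀`, where `M B =
  -- 1`.
  let Hm : Fin h → (Fin h → ChartIndex n → ℂ) → MonomialIndex n d → ℂ := fun i t =>
    (jetMatrix d t * B).det • H₀ i
      - B.mulVec ((jetMatrix d t * B).adjugate.mulVec ((jetMatrix d t).mulVec (H₀ i)))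
  have hHm : ∀ i t, Hm i t ∈ singularForms d t := by
    intro i t
    change (jetMatrix d t).mulVec (Hm i t) = 0
    simp only [Hm, Matrix.mulVec_sub, Matrix.mulVec_smul]
    rw [Matrix.mulVec_mulVec, Matrix.mulVec_mulVec, Matrix.mul_adjugate, Matrix.smul_mulVec,
      Matrix.one_mulVec, sub_self]
  have hHm0 : ∀ i, Hm i t₀ = H₀ i := by
    intro i
    have : (jetMatrix d t₀).mulVec (H₀ i) = 0 := hH₀ i
    simp only [Hm, hB, this, Matrix.det_one, one_smul, Matrix.mulVec_zero, sub_zero]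
  have hHmd : ∀ i J, Differentiable ℂ fun t => Hm i t J := by
    intro i J
    simp only [Hm, Pi.sub_apply, Pi.smul_apply, smul_eq_mul, Matrix.mulVec, dotProduct]
    refine ((differentiable_det hMB).mul_const _).fun_sub ?_
    refine Differentiable.fun_sum fun p _ => Differentiable.const_mul ?_ _
    refine Differentiable.fun_sum fun q _ => (differentiable_adjugate hMB p q).fun_mul ?_
    exact Differentiable.fun_sum fun J _ => (differentiable_jetMatrix q J).mul_const _
  obtain ⟨t, ht⟩ := exists_forall_ne_zero (Finset.univ : Finset (Option (Fin h)))
    (fun o t => o.elim (f t) fun i => (hessian (chartForm (Hm i t)) (t i)).det) (by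
      rintro (_ | i) _
      · exact hf
      · refine differentiable_det fun l b => ?_
        simp only [hessian_chartForm_apply]
        exact Differentiable.fun_sum fun J _ => (hHmd i J).fun_mul (differentiable_eval_apply _ i))
    (by
      rintro (_ | i) _
      · exact hf0
      · exact ⟨t₀, by simpa [hHm0] using hess₀ i⟩)
  exact ⟨t, ht none (Finset.mem_univ _), fun i =>
    ⟨Hm i t, hHm i t, ht (some i) (Finset.mem_univ _)⟩⟩

theorem differentiable_monomialMap (J : MonomialIndex n d) :
    Differentiable ℂ fun x : (k : Fin r) → Fin (n k + 1) → ℂ => monomialMap n d x J := by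
  unfold monomialMap
  refine differentiable_prod _ fun k _ => ?_
  generalize ((J k : Multiset (Fin (n k + 1)))) = m
  induction m using Multiset.induction_on with
  | empty => simp
  | cons a m ih =>
    simp only [Multiset.map_cons, Multiset.prod_cons]
    refine Differentiable.fun_mul ?_ ih
    fun_prop

/-- Pulled back to tuples of homogeneous coordinates, `U` contains a nonempty basic open set, which
must meet the locus where all zeroth coordinates are nonzero. -/
theorem exists_chartImage_mem_of_isOpen
    {U : Set (Fin h → ℙ ℂ (MonomialIndex n d → ℂ))} (hU : @IsOpen _ (multiProjZariski h _) U)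
    {x : Fin h → ℙ ℂ (MonomialIndex n d → ℂ)} (hxU : x ∈ U) (hx : ∀ i, x i ∈ segreVeronese n d) :
    ∃ t : Fin h → ChartIndex n → ℂ, (fun i => chartImage (t i)) ∈ U := by
  choose y hy0 hy hxy using hx
  obtain rfl : x = fun i => Projectivization.mk ℂ _ (hy i) := funext hxy
  obtain ⟨F, hF, hFU⟩ := exists_basicOpen_multiProj hU hy hxU
  obtain ⟨z, hz⟩ := exists_forall_ne_zero (Finset.univ : Finset (Option (Fin h × Fin r)))
    (E := Fin h → (k : Fin r) → Fin (n k + 1) → ℂ)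
    (fun o z => o.elim (eval (fun p : Fin h × MonomialIndex n d => monomialMap n d (z p.1) p.2) F)
      fun q => z q.1 q.2 0) (by
        rintro (_ | q) _
        · refine (differentiable_eval F).comp (differentiable_pi.2 fun p => ?_)
          exact (differentiable_monomialMap p.2).comp (differentiable_apply p.1)
        · change Differentiable ℂ
            fun z : Fin h → (k : Fin r) → Fin (n k + 1) → ℂ => z q.1 q.2 0
          fun_prop) (by
        rintro (_ | q) _
        · exact ⟨y, hF⟩
        · exact ⟨fun _ _ _ => 1, one_ne_zero⟩)
  have hz0 : ∀ i k, z i k 0 ≠ 0 := fun i k => hz (some (i, k)) (Finset.mem_univ _)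
  have hprod : ∀ i, ∏ k, z i k 0 ^ d k ≠ 0 := fun i =>
    Finset.prod_ne_zero_iff.2 fun k _ => pow_ne_zero _ (hz0 i k)
  have hne : ∀ i, monomialMap n d (z i) ≠ 0 := by
    intro i
    rw [monomialMap_eq_smul _ (hz0 i)]
    exact smul_ne_zero (hprod i) (monomialMap_chartPoint_ne_zero _)
  have := hFU _ hne (hz none (Finset.mem_univ _))
  refine ⟨fun i l => z i l.1 l.2.succ / z i l.1 0, ?_⟩
  convert this using 2 with i
  rw [chartImage, Projectivization.mk_eq_mk_iff']
  refine ⟨(∏ k, z i k 0 ^ d k)⁻¹, ?_⟩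
  conv_lhs => rw [monomialMap_eq_smul _ (hz0 i)]
  rw [smul_smul, inv_mul_cancel₀ (hprod i), one_smul]

theorem hessian_smul {σ : Type*} (c : ℂ) (P : MvPolynomial σ ℂ) (t : σ → ℂ) :
    hessian (c • P) t = c • hessian P t := by
  ext l b
  simp [hessian, smul_eval]

theorem not_isWeaklyDefective_of_special (hd : ∀ k, 1 ≤ d k) (t₀ : Fin h → ChartIndex n → ℂ)
    (hjet : Function.Surjective (jetMatrix d t₀).mulVec)
    (hess : ∀ i, ∃ H ∈ singularForms d t₀, (hessian (chartForm H) (t₀ i)).det ≠ 0) :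
    ¬ IsWeaklyDefective (segreVeronese n d) h := by
  rintro ⟨U, hU, ⟨x, hxU, hx⟩, hall⟩
  obtain ⟨s, hs⟩ := exists_chartImage_mem_of_isOpen hU hxU hx
  obtain ⟨F, hF, hFU⟩ := exists_basicOpen_multiProj hU
    (fun i => monomialMap_chartPoint_ne_zero (s i)) hs
  obtain ⟨t, htF, hess⟩ := exists_nondegenerate_of_special t₀ hjet hess
    (f := fun t => eval (fun p : Fin h × MonomialIndex n d =>
      monomialMap n d (chartPoint (t p.1)) p.2) F) (by
        refine (differentiable_eval F).comp (differentiable_pi.2 fun p => ?_)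
        simp only [← eval_chartMonomial]
        exact differentiable_eval_apply _ _) ⟨s, hF⟩
  have htU := hFU _ (fun i => monomialMap_chartPoint_ne_zero (t i)) htF
  obtain ⟨W, hW, ⟨H₁, hH₁W, hH₁⟩, hWall⟩ := hall _ htU fun i => chartImage_mem (t i)
  have hTH : ∀ H : ℙ ℂ (MonomialIndex n d → ℂ),
      H ∈ tangentHyperplanes (segreVeronese n d) (fun i => chartImage (t i)) ↔
        H.rep ∈ singularForms d t := by
    intro H
    rw [mem_singularForms]
    simp only [tangentHyperplanes, Set.mem_ofPred_eq, iSup_le_iff]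
    exact forall_congr' fun i => tangentSpace_le_hyperplane_iff hd (t i) H
  have hH₁' := (hTH H₁).1 hH₁
  obtain ⟨G, hG, hGW⟩ := exists_basicOpen_proj hW H₁.rep_nonzero (by rwa [H₁.mk_rep])
  obtain ⟨a, ha⟩ := Function.ne_iff.1 H₁.rep_nonzero
  -- The forms singular at the tuple make up a vector space, so a single one can be nonzero, lie
  -- over `W` and have nondegenerate Hessians at all points, although each condition has its own
  -- witness.
  obtain ⟨v, hv⟩ := exists_forall_ne_zero (Finset.univ : Finset (Bool ⊕ Fin h))
    (E := singularForms d t)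
    (fun o v => o.elim (fun b => if b then eval v.1 G else v.1 a)
      fun i => (hessian (chartForm v.1) (t i)).det) (by
        have hval : Differentiable ℂ fun v : singularForms d t => v.1 :=
          (singularForms d t).subtypeL.differentiable
        rintro ((_ | _) | i) _
        · exact (differentiable_apply a).comp hval
        · exact (differentiable_eval G).comp hval
        · refine differentiable_det fun l b => ?_
          simp only [hessian_chartForm_apply]
          exact Differentiable.fun_sum fun J _ =>
            ((differentiable_apply J).comp hval).mul_const _) (by
        rintro ((_ | _) | i) _
        · exact ⟨⟨_, hH₁'⟩, ha⟩
        · exact ⟨⟨_, hH₁'⟩, hG⟩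
        · obtain ⟨H, hH, hHi⟩ := hess i
          exact ⟨⟨H, hH⟩, hHi⟩)
  have hv0 : v.1 ≠ 0 := Function.ne_iff.2 ⟨a, hv (Sum.inl false) (Finset.mem_univ _)⟩
  obtain ⟨c, hc⟩ := Projectivization.exists_smul_eq_mk_rep ℂ v.1 hv0
  rw [Units.smul_def] at hc
  set H := Projectivization.mk ℂ v.1 hv0
  have hHsing : H.rep ∈ singularForms d t := by
    rw [← hc]
    exact (singularForms d t).smul_mem _ v.2
  have hpos := hWall H ⟨hGW _ hv0 (hv (Sum.inl true) (Finset.mem_univ _)), (hTH H).2 hHsing⟩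
  refine absurd hpos (not_lt.2 (projDim_nonpos_of_subset_range (fun i => chartImage (t i)) ?_))
  rintro z ⟨Z, ⟨hZ, i, hi⟩, hz⟩
  refine ⟨i, ?_⟩
  refine (isComponent_subset_singleton hd (t i) (mem_singularForms.1 hHsing i) ?_ hZ hi hz).symm
  rw [← hc, map_smul, hessian_smul, Matrix.det_smul]
  exact mul_ne_zero (pow_ne_zero _ c.ne_zero) (hv (Sum.inr i) (Finset.mem_univ _))

theorem subset_secantVariety {ι : Type*} [Fintype ι] (X : Set (ℙ ℂ (ι → ℂ))) (h : ℕ) :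
    {p | ∃ x : Fin h → ℙ ℂ (ι → ℂ), (∀ i, x i ∈ X) ∧
      p.rep ∈ Submodule.span ℂ (Set.range fun i => (x i).rep)} ⊆ secantVariety X h :=
  @subset_closure _ (projZariski ι) _

theorem sum_mem_cone_secantVariety (s : Fin h → ℂ) (t : Fin h → ChartIndex n → ℂ)
    (h0 : ∑ i, s i • monomialMap n d (chartPoint (t i)) ≠ 0) :
    ∑ i, s i • monomialMap n d (chartPoint (t i)) ∈
      cone (secantVariety (segreVeronese n d) h) := by
  refine ⟨h0, subset_secantVariety _ _ ⟨fun i => chartImage (t i), fun i => chartImage_mem _, ?_⟩⟩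
  obtain ⟨c, hc⟩ := Projectivization.exists_smul_eq_mk_rep ℂ _ h0
  rw [← hc, Units.smul_def]
  refine Submodule.smul_mem _ _ (Submodule.sum_mem _ fun i _ => Submodule.smul_mem _ _ ?_)
  obtain ⟨e, he, hrep⟩ := exists_smul_eq_rep_chartImage (d := d) (t i)
  have : monomialMap n d (chartPoint (t i)) =
      e⁻¹ • (chartImage (t i) : ℙ ℂ (MonomialIndex n d → ℂ)).rep := by
    rw [hrep, smul_smul, inv_mul_cancel₀ he, one_smul]
  rw [this]
  exact Submodule.smul_mem _ _ (Submodule.subset_span ⟨i, rfl⟩)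

/-- Independence of the `1`-jets at some `h` points implies nondefectivity. -/
theorem not_isDefective_of_special (hh : 1 ≤ h) (t₀ : Fin h → ChartIndex n → ℂ)
    (hjet : Function.Surjective (jetMatrix d t₀).mulVec) :
    ¬ IsDefective (segreVeronese n d) h := by
  classical
  choose B hB using fun p => hjet (Pi.single p 1)
  -- `Ψ` is the parametrization of the secant cone followed by the forms `B p` dual to the jets. Its
  -- derivative at scalars `1` and points `t₀` is the identity up to indexing, so the `B p` are
  -- algebraically independent on the secant variety.
  let Ψ : (Fin h → ℂ) × (Fin h → ChartIndex n → ℂ) → (Fin h × Option (ChartIndex n)) → ℂ :=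
    fun z p => ∑ i, z.1 i * eval (z.2 i) (chartForm (B p))
  let a : (Fin h → ℂ) × (Fin h → ChartIndex n → ℂ) := (fun _ => 1, t₀)
  have hΨ : ContDiff ℂ 1 Ψ := by
    refine contDiff_pi.2 fun p => ContDiff.sum fun i _ => ContDiff.mul ?_ ?_
    · exact (contDiff_apply ℂ ℂ i).comp contDiff_fst
    · exact (contDiff_eval _).comp ((contDiff_apply ℂ _ i).comp contDiff_snd)
  have hstrict := hΨ.contDiffAt.hasStrictFDerivAt (x := a) one_ne_zero
  have hdir : ∀ v p, HasDerivAt (fun s : ℂ => Ψ (a + s • v) p) (fderiv ℂ Ψ a v p) 0 := by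
    intro v p
    have h1 : HasFDerivAt Ψ (fderiv ℂ Ψ a) (a + (0 : ℂ) • v) := by
      simpa using hstrict.hasFDerivAt
    have h2 : HasDerivAt (fun s : ℂ => a + s • v) v 0 := by
      simpa using ((hasDerivAt_id (0 : ℂ)).smul_const v).const_add a
    exact (hasDerivAt_pi.1 (h1.comp_hasDerivAt (0 : ℂ) h2)) p
  have hBnone : ∀ p i, eval (t₀ i) (chartForm (B p)) = if (i, none) = p then 1 else 0 := by
    intro p i
    rw [← jetMatrix_mulVec_none, hB, Pi.single_apply]
  have hBsome : ∀ p i l, eval (t₀ i) (pderiv l (chartForm (B p)))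
      = if (i, some l) = p then 1 else 0 := by
    intro p i l
    rw [← jetMatrix_mulVec_some, hB, Pi.single_apply]
  have hsurj : (fderiv ℂ Ψ a).range = ⊤ := by
    refine LinearMap.range_eq_top.2 fun y => ⟨(fun i => y (i, none), fun i l => y (i, some l)), ?_⟩
    ext p
    set v : (Fin h → ℂ) × (Fin h → ChartIndex n → ℂ) :=
      (fun i => y (i, none), fun i l => y (i, some l)) with hv
    have h1 : HasDerivAt (fun s : ℂ => Ψ (a + s • v) p)
        (∑ i, (v.1 i * eval (t₀ i) (chartForm (B p))
          + ∑ l, eval (t₀ i) (pderiv l (chartForm (B p))) * v.2 i l)) 0 := by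
      refine HasDerivAt.fun_sum fun i _ => ?_
      have h2 : HasDerivAt (fun s : ℂ => (a + s • v).1 i) (v.1 i) 0 := by
        simpa using ((hasDerivAt_id (0 : ℂ)).mul_const (v.1 i)).const_add (a.1 i)
      have h3 := hasDerivAt_eval (chartForm (B p)) (s := 0) (γ := fun s : ℂ => (a + s • v).2 i)
        (γ' := v.2 i) (by
          intro l
          simpa using ((hasDerivAt_id (0 : ℂ)).mul_const (v.2 i l)).const_add (a.2 i l))
      simpa [a] using h2.fun_mul h3
    refine ((hdir v p).unique h1).trans ?_
    simp only [hBnone, hBsome, hv]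
    obtain ⟨i, _ | l⟩ := p
    · simp
    · simp only [Prod.mk.injEq, reduceCtorEq, and_false, if_false, mul_zero, zero_add,
        Option.some.injEq, ite_and]
      rw [Finset.sum_eq_single i (by intro j _ hj; simp [hj]) (by simp)]
      simp
  have hle : (Fintype.card (Fin h × Option (ChartIndex n)) : ℤ) - 1
      ≤ projDim (secantVariety (segreVeronese n d) h) := by
    refine le_projDim_of_algebraicIndependent (fun p => ∑ J, C (B p J) * X J) fun P hP => ?_
    refine eq_zero_of_eval_comp_eq_zero hstrict hsurj ?_
    have hcont : Continuous fun z : (Fin h → ℂ) × (Fin h → ChartIndex n → ℂ) => ∑ i, z.1 i := by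
      fun_prop
    -- This sum is the `baseIndex` coordinate, so it keeps the combination off the vertex; at `a` it
    -- equals `h`, which is positive.
    have hne : ∀ᶠ z in 𝓝 a, ∑ i, z.1 i ≠ 0 :=
      hcont.continuousAt.eventually_ne (by simp [a]; omega)
    filter_upwards [hne] with z hz
    have hbase : (∑ i, z.1 i • monomialMap n d (chartPoint (z.2 i))) baseIndex = ∑ i, z.1 i := by
      simp [monomialMap_eq, monomialEval_chartPoint_baseIndex]
    have := hP _ (sum_mem_cone_secantVariety z.1 z.2 fun h0 => hz (by rw [← hbase, h0]; rfl))
    convert this using 2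
    congr 1
    ext p
    simp only [Ψ, eval_chartForm, map_sum, map_mul, eval_C, eval_X, dotProduct, Finset.sum_apply,
      Pi.smul_apply, smul_eq_mul, Finset.mul_sum]
    rw [Finset.sum_comm]
    exact Finset.sum_congr rfl fun _ _ => Finset.sum_congr rfl fun _ _ => by ring
  have hX : projDim (segreVeronese n d) ≤ Fintype.card (ChartIndex n) := projDim_segreVeronese_le
  unfold IsDefective
  rw [not_lt]
  refine (min_le_left _ _).trans (le_trans ?_ hle)
  rw [Fintype.card_prod, Fintype.card_option, Fintype.card_fin]
  push_cast
  nlinarith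

end Generic

/-! ### Multidegrees on the chart -/

section MultiDegree

variable {r : ℕ} {n : Fin r → ℕ}

/-- The polynomials on the chart whose degree in the `k`-th group of variables is at most `e k`. -/
def degreeLE (n e : Fin r → ℕ) : Submodule ℂ (MvPolynomial (ChartIndex n) ℂ) :=
  restrictSupport ℂ {s | ∀ k, ∑ b, s ⟨k, b⟩ ≤ e k}

theorem degreeLE_mono {e e' : Fin r → ℕ} (h : e ≤ e') : degreeLE n e ≤ degreeLE n e' :=
  restrictSupport_mono ℂ fun _ hs k => (hs k).trans (h k)

theorem mul_mem_degreeLE {e e' : Fin r → ℕ} {P Q : MvPolynomial (ChartIndex n) ℂ}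
    (hP : P ∈ degreeLE n e) (hQ : Q ∈ degreeLE n e') : P * Q ∈ degreeLE n (e + e') := by
  have h1 : P * Q ∈ degreeLE n e * degreeLE n e' := Submodule.mul_mem_mul hP hQ
  rw [degreeLE, degreeLE, ← restrictSupport_add] at h1
  refine restrictSupport_mono ℂ ?_ h1
  rintro _ ⟨s, hs, u, hu, rfl⟩ k
  simp only [Finsupp.add_apply, Finset.sum_add_distrib, Pi.add_apply]
  exact add_le_add (hs k) (hu k)

theorem C_mem_degreeLE (e : Fin r → ℕ) (c : ℂ) : C c ∈ degreeLE n e := by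
  rw [C_apply]
  exact (monomial_mem_restrictSupport ℂ).2 (Or.inl fun k => by simp)

theorem X_mem_degreeLE (l : ChartIndex n) : X l ∈ degreeLE n (Pi.single l.1 1) := by
  classical
  refine (monomial_mem_restrictSupport ℂ).2 (Or.inl fun k => ?_)
  obtain ⟨j, c⟩ := l
  by_cases h : k = j
  · subst h
    simp [Finsupp.single_apply]
  · simp [h]

theorem X_sub_C_mem_degreeLE (l : ChartIndex n) (c : ℂ) :
    X l - C c ∈ degreeLE n (Pi.single l.1 1) :=
  Submodule.sub_mem _ (X_mem_degreeLE l) (C_mem_degreeLE _ c)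

theorem rename_mem_degreeLE {σ : Type*} {k : Fin r} (f : σ → Fin (n k)) {e : ℕ}
    {G : MvPolynomial σ ℂ} (hG : G ∈ restrictTotalDegree σ ℂ e) :
    rename (fun b => (⟨k, f b⟩ : ChartIndex n)) G ∈ degreeLE n (Pi.single k e) := by
  classical
  have hle : restrictTotalDegree σ ℂ e ≤ (degreeLE n (Pi.single k e)).comap
      (rename (R := ℂ) fun b => (⟨k, f b⟩ : ChartIndex n)).toLinearMap := by
    rw [restrictTotalDegree, restrictSupport_eq_span, Submodule.span_le]
    rintro _ ⟨s, hs, rfl⟩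
    simp only [SetLike.mem_coe, Submodule.mem_comap, AlgHom.toLinearMap_apply, rename_monomial]
    refine (monomial_mem_restrictSupport ℂ).2 (Or.inl fun j => ?_)
    by_cases h : j = k
    · subst h
      rw [Pi.single_eq_same]
      have h1 : ∑ l, (Finsupp.mapDomain (fun b => (⟨j, f b⟩ : ChartIndex n)) s) l ≤ e := by
        rw [← Finsupp.sum_fintype _ (fun _ x => x) (fun _ => rfl),
          Finsupp.sum_mapDomain_index (fun _ => rfl) (fun _ _ _ => rfl)]
        exact hs
      rw [Fintype.sum_sigma] at h1
      exact (Finset.single_le_sum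
        (f := fun k => ∑ b, (Finsupp.mapDomain (fun b => (⟨j, f b⟩ : ChartIndex n)) s) ⟨k, b⟩)
        (fun _ _ => Nat.zero_le _) (Finset.mem_univ j)).trans h1
    · rw [Finset.sum_eq_zero fun b _ => ?_]
      · exact Nat.zero_le _
      · refine Finsupp.mapDomain_of_notMem_range _ _ ?_
        rintro ⟨c, hc⟩
        exact h (congrArg Sigma.fst hc).symm
  exact hle hG

/-- Every polynomial of multidegree at most `d` on the chart is the restriction of a linear form. -/
theorem exists_chartForm_eq {d : Fin r → ℕ} {P : MvPolynomial (ChartIndex n) ℂ}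
    (hP : P ∈ degreeLE n d) : ∃ H : MonomialIndex n d → ℂ, chartForm H = P := by
  classical
  have hle : degreeLE n d ≤ LinearMap.range (chartForm (n := n) (d := d)) := by
    rw [degreeLE, restrictSupport_eq_span, Submodule.span_le]
    rintro _ ⟨s, hs, rfl⟩
    have hs' : ∀ k, ∑ b, s ⟨k, b⟩ ≤ d k := hs
    -- Homogenization: the missing degree in each factor is filled with the zeroth coordinate, which
    -- is `1` on the chart.
    let J : MonomialIndex n d := fun k => Sym.mk
      (∑ b : Fin (n k), Multiset.replicate (s ⟨k, b⟩) b.succ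
        + Multiset.replicate (d k - ∑ b, s ⟨k, b⟩) 0) (by
          have := hs' k
          simp
          omega)
    refine ⟨Pi.single J 1, ?_⟩
    rw [chartForm_apply, Finset.sum_eq_single J (by intro K _ hK; simp [hK]) (by simp),
      Pi.single_eq_same, one_smul]
    change _ = monomial s 1
    rw [chartMonomial, monomialEval, monomial_eq, C_1, one_mul,
      Finsupp.prod_fintype _ _ (by simp), Fintype.prod_sigma]
    refine Finset.prod_congr rfl fun k _ => ?_
    simp only [J, Sym.coe_mk, Multiset.map_add, Multiset.prod_add, Multiset.map_replicate,
      Multiset.prod_replicate]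
    have h0 : chartPoint (X : ChartIndex n → MvPolynomial (ChartIndex n) ℂ) k 0 = 1 := by
      simp [chartPoint]
    rw [h0, one_pow, mul_one]
    have hsum : ∀ A : Finset (Fin (n k)), (Multiset.map (chartPoint (X : ChartIndex n → _) k)
        (∑ b ∈ A, Multiset.replicate (s ⟨k, b⟩) b.succ)).prod
          = ∏ b ∈ A, (X ⟨k, b⟩ : MvPolynomial (ChartIndex n) ℂ) ^ s ⟨k, b⟩ := by
      intro A
      induction A using Finset.induction_on with
      | empty => simp
      | insert a A ha ih =>
        rw [Finset.sum_insert ha, Finset.prod_insert ha, Multiset.map_add, Multiset.prod_add, ih]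
        simp [chartPoint]
    exact hsum _
  exact hle hP

end MultiDegree

/-! ### Jets of products -/

section Jets

variable {σ : Type*} {t : σ → ℂ} {P Q : MvPolynomial σ ℂ}

theorem SingularAt.add (hP : SingularAt P t) (hQ : SingularAt Q t) : SingularAt (P + Q) t :=
  ⟨by simp [hP.1, hQ.1], fun l => by simp [hP.2 l, hQ.2 l]⟩

theorem SingularAt.sum {κ : Type*} {s : Finset κ} {P : κ → MvPolynomial σ ℂ}
    (hP : ∀ i ∈ s, SingularAt (P i) t) : SingularAt (∑ i ∈ s, P i) t :=
  ⟨by simpa using Finset.sum_eq_zero fun i hi => (hP i hi).1,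
    fun l => by simpa using Finset.sum_eq_zero fun i hi => (hP i hi).2 l⟩

theorem singularAt_mul (hP : eval t P = 0) (hQ : eval t Q = 0) : SingularAt (P * Q) t :=
  ⟨by simp [hP], fun l => by simp [hP, hQ]⟩

theorem SingularAt.mul_left (hP : SingularAt P t) (Q : MvPolynomial σ ℂ) : SingularAt (Q * P) t :=
  ⟨by simp [hP.1], fun l => by simp [hP.1, hP.2]⟩

theorem SingularAt.mul_right (hP : SingularAt P t) (Q : MvPolynomial σ ℂ) : SingularAt (P * Q) t :=
  mul_comm Q P ▸ hP.mul_left Q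

theorem hessian_mul_of_singularAt (Q : MvPolynomial σ ℂ) (hP : SingularAt P t) :
    hessian (Q * P) t = eval t Q • hessian P t := by
  ext l b
  simp [hessian, hP.1, hP.2]

theorem hessian_add (P Q : MvPolynomial σ ℂ) (t : σ → ℂ) :
    hessian (P + Q) t = hessian P t + hessian Q t := by
  ext l b
  simp [hessian]

theorem hessian_sum {κ : Type*} (s : Finset κ) (P : κ → MvPolynomial σ ℂ) (t : σ → ℂ) :
    hessian (∑ i ∈ s, P i) t = ∑ i ∈ s, hessian (P i) t := by
  classical
  ext l b
  simp [hessian, Matrix.sum_apply]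

/-- `f` and `P` have the same leading `2`-jet at `t`. -/
structure SameLeadingJet (f P : MvPolynomial σ ℂ) (t : σ → ℂ) : Prop where
  eval_eq : eval t f = eval t P
  pderiv_eq : eval t P = 0 → ∀ l, eval t (pderiv l f) = eval t (pderiv l P)
  hessian_eq : SingularAt P t → hessian f t = hessian P t

theorem sameLeadingJet_mul_add {u E : MvPolynomial σ ℂ} (P : MvPolynomial σ ℂ)
    (hu : eval t u = 1) (hE : SingularAt E t) (hE' : hessian E t = 0) :
    SameLeadingJet (u * (P + E)) P t where
  eval_eq := by simp [hu, hE.1]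
  pderiv_eq hP l := by simp [hu, hE.1, hE.2, hP]
  hessian_eq hP := by
    rw [hessian_mul_of_singularAt _ (hP.add hE), hu, one_smul, hessian_add, hE', add_zero]

end Jets

/-! ### Forms with prescribed jets at special points -/

section LocalForms

variable {r : ℕ} {n d : Fin r → ℕ} {h : ℕ}

/-- Every polynomial of multidegree at most `e` has the leading `2`-jet at `t i` of some form of
multidegree at most `d` that is singular at the other points `t j`. -/
def HasLocalForms (n d e : Fin r → ℕ) (t : Fin h → ChartIndex n → ℂ) : Prop :=
  ∀ i, ∀ P ∈ degreeLE n e, ∃ f ∈ degreeLE n d,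
    (∀ j, j ≠ i → SingularAt f (t j)) ∧ SameLeadingJet f P (t i)

theorem HasLocalForms.surjective_jetMatrix {e : Fin r → ℕ} {t : Fin h → ChartIndex n → ℂ}
    (hloc : HasLocalForms n d e t) (he : ∀ k, 1 ≤ e k) :
    Function.Surjective (jetMatrix d t).mulVec := by
  classical
  have hsome : ∀ i l, Pi.single (i, some l) 1 ∈ LinearMap.range (jetMatrix d t).mulVecLin := by
    intro i l
    obtain ⟨f, hf, hsing, hjet⟩ := hloc i (X l - C (t i l)) (degreeLE_mono (by
      intro k
      by_cases hk : k = l.1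
      · subst hk; simpa using he l.1
      · simp [hk]) (X_sub_C_mem_degreeLE l _))
    obtain ⟨H, rfl⟩ := exists_chartForm_eq hf
    refine ⟨H, ?_⟩
    have h0 : eval (t i) (X l - C (t i l)) = 0 := by simp
    ext ⟨j, o⟩
    rw [Matrix.mulVecLin_apply]
    by_cases hj : j = i
    · subst hj
      cases o with
      | none => rw [jetMatrix_mulVec_none, hjet.eval_eq, h0]; simp
      | some m =>
        rw [jetMatrix_mulVec_some, hjet.pderiv_eq h0]
        by_cases hm : m = l
        · subst hm; simp
        · simp [Ne.symm hm, hm]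
    · cases o with
      | none => rw [jetMatrix_mulVec_none, (hsing j hj).1]; simp [hj]
      | some m => rw [jetMatrix_mulVec_some, (hsing j hj).2]; simp [hj]
  have hnone : ∀ i, Pi.single (i, none) 1 ∈ LinearMap.range (jetMatrix d t).mulVecLin := by
    intro i
    obtain ⟨f, hf, hsing, hjet⟩ := hloc i 1 (by simpa using C_mem_degreeLE (n := n) e 1)
    -- The local form for `1` has the right value but an uncontrolled gradient, which is removed
    -- with the vectors from `hsome`.
    obtain ⟨H, rfl⟩ := exists_chartForm_eq hf
    have : Pi.single (i, none) 1 = (jetMatrix d t).mulVecLin H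
        - ∑ l, eval (t i) (pderiv l (chartForm H)) • Pi.single (i, some l) 1 := by
      ext ⟨j, o⟩
      rw [Pi.sub_apply, Matrix.mulVecLin_apply]
      simp only [Finset.sum_apply, Pi.smul_apply, smul_eq_mul]
      by_cases hj : j = i
      · subst hj
        cases o with
        | none => rw [jetMatrix_mulVec_none, hjet.eval_eq]; simp
        | some m =>
          rw [jetMatrix_mulVec_some, Finset.sum_eq_single m]
          · simp
          · intro b _ hb; simp [Ne.symm hb]
          · simp
      · cases o with
        | none => rw [jetMatrix_mulVec_none, (hsing j hj).1]; simp [hj]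
        | some m => rw [jetMatrix_mulVec_some, (hsing j hj).2]; simp [hj]
    rw [this]
    exact Submodule.sub_mem _ ⟨H, rfl⟩
      (Submodule.sum_mem _ fun l _ => Submodule.smul_mem _ _ (hsome i l))
  intro y
  have : y ∈ LinearMap.range (jetMatrix d t).mulVecLin := by
    rw [pi_eq_sum_univ' y]
    refine Submodule.sum_mem _ fun p _ => Submodule.smul_mem _ _ ?_
    obtain ⟨i, _ | l⟩ := p
    · exact hnone i
    · exact hsome i l
  exact this

/-- The quadratic form that pairs every coordinate, centred at `t`, with its image under an
involution. -/
def pairing (t : ChartIndex n → ℂ) (π : ChartIndex n → ChartIndex n) (l : ChartIndex n) :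
    MvPolynomial (ChartIndex n) ℂ :=
  C (1 / 2) * ((X l - C (t l)) * (X (π l) - C (t (π l))))

theorem singularAt_pairing (t : ChartIndex n → ℂ) (π : ChartIndex n → ChartIndex n)
    (l : ChartIndex n) : SingularAt (pairing t π l) t :=
  (singularAt_mul (by simp) (by simp)).mul_left _

/-- A two-element orbit occurs twice in the sum, and a fixed coordinate contributes half its square;
in both cases the factor `1 / 2` leaves entries equal to `1`. -/
theorem hessian_sum_pairing [DecidableEq (ChartIndex n)] (t : ChartIndex n → ℂ)
    {π : ChartIndex n → ChartIndex n} (hπ : Function.Involutive π) :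
    hessian (∑ l, pairing t π l) t = (hπ.toPerm.permMatrix ℂ) := by
  ext a b
  simp only [hessian, pairing, Matrix.of_apply, map_sum]
  have : ∀ l, eval t (pderiv b (pderiv a
      (C (1 / 2) * ((X l - C (t l)) * (X (π l) - C (t (π l))))))) =
      (1 / 2) * ((if l = a then if π l = b then 1 else 0 else 0)
        + (if l = b then if π l = a then 1 else 0 else 0)) := by
    intro l
    have hX : ∀ x y : ChartIndex n, pderiv x (X y) =
        (C (if y = x then 1 else 0) : MvPolynomial (ChartIndex n) ℂ) := by
      intro x y
      rw [pderiv_X, Pi.single_apply]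
      split_ifs <;> simp
    simp only [pderiv_mul, pderiv_C, map_sub, map_add, map_mul, hX, eval_C, eval_X]
    split_ifs <;> simp
  simp only [this, ← Finset.mul_sum, Finset.sum_add_distrib, Finset.sum_ite_eq', Finset.mem_univ,
    if_true, Equiv.Perm.permMatrix, Equiv.toPEquiv_apply, PEquiv.toMatrix_apply]
  have hab : π b = a ↔ π a = b := ⟨fun e => by rw [← e, hπ b], fun e => by rw [← e, hπ a]⟩
  by_cases e : π a = b
  · simp [e, hab.2 e]; norm_num
  · simp [e, hab]

/-- Pairs within multidegree `e` are realized by a local form. The remaining coordinates vanish at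
all the points, so their squares are singular everywhere required and are simply added. The total
Hessian is a permutation matrix, with determinant `±1`. -/
theorem HasLocalForms.exists_hessian [DecidableEq (ChartIndex n)] {e : Fin r → ℕ}
    {t : Fin h → ChartIndex n → ℂ} (hloc : HasLocalForms n d e t)
    {π : ChartIndex n → ChartIndex n} (hπ : Function.Involutive π)
    (hdeg : ∀ l, Pi.single l.1 1 + Pi.single (π l).1 1 ≤ e ∨
      (π l = l ∧ 2 ≤ d l.1 ∧ ∀ j, t j l = 0)) (i : Fin h) :
    ∃ H ∈ singularForms d t, (hessian (chartForm H) (t i)).det ≠ 0 := by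
  classical
  let S : Finset (ChartIndex n) :=
    Finset.univ.filter fun l => Pi.single l.1 1 + Pi.single (π l).1 1 ≤ e
  obtain ⟨f, hf, hsing, hjet⟩ := hloc i (∑ l ∈ S, pairing (t i) π l) (by
    refine Submodule.sum_mem _ fun l hl => ?_
    rw [pairing, C_mul']
    refine Submodule.smul_mem _ _ (degreeLE_mono (Finset.mem_filter.1 hl).2
      (mul_mem_degreeLE (X_sub_C_mem_degreeLE _ _) (X_sub_C_mem_degreeLE _ _))))
  have hout : ∀ l ∈ Sᶜ, π l = l ∧ 2 ≤ d l.1 ∧ ∀ j, t j l = 0 := by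
    intro l hl
    refine (hdeg l).resolve_left fun hle => ?_
    exact Finset.mem_compl.1 hl (Finset.mem_filter.2 ⟨Finset.mem_univ _, hle⟩)
  have hQ : ∑ l ∈ Sᶜ, pairing (t i) π l ∈ degreeLE n d := by
    refine Submodule.sum_mem _ fun l hl => ?_
    obtain ⟨hl1, hl2, -⟩ := hout l hl
    rw [pairing, C_mul']
    refine Submodule.smul_mem _ _ (degreeLE_mono ?_
      (mul_mem_degreeLE (X_sub_C_mem_degreeLE _ _) (X_sub_C_mem_degreeLE _ _)))
    rw [hl1]
    intro k
    by_cases hk : k = l.1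
    · subst hk; simpa using hl2
    · simp [hk]
  have hQs : ∀ j, SingularAt (∑ l ∈ Sᶜ, pairing (t i) π l) (t j) := by
    intro j
    refine SingularAt.sum fun l hl => ?_
    obtain ⟨hl1, -, hl3⟩ := hout l hl
    refine (singularAt_mul ?_ ?_).mul_left _ <;> simp [hl1, hl3]
  have hSs : SingularAt (∑ l ∈ S, pairing (t i) π l) (t i) :=
    SingularAt.sum fun l _ => singularAt_pairing _ _ _
  obtain ⟨H, hH⟩ := exists_chartForm_eq (Submodule.add_mem _ hf hQ)
  refine ⟨H, mem_singularForms.2 fun j => ?_, ?_⟩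
  · rw [hH]
    refine SingularAt.add ?_ (hQs j)
    by_cases hj : j = i
    · subst hj
      exact ⟨hjet.eval_eq.trans hSs.1, fun l => (hjet.pderiv_eq hSs.1 l).trans (hSs.2 l)⟩
    · exact hsing j hj
  · rw [hH, hessian_add, hjet.hessian_eq hSs, ← hessian_add, Finset.sum_add_sum_compl,
      hessian_sum_pairing _ hπ, Matrix.det_permutation]
    simp

end LocalForms

/-! ### Local forms at diagonal points. -/

section SpecialPoints

variable {r : ℕ} {n d : Fin r → ℕ} {h N : ℕ}

/-- The diagonal point of the chart with the coordinates `q` in each factor, padded with zeros. -/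
def diagonalPoint (n : Fin r → ℕ) (q : Fin N → ℂ) : ChartIndex n → ℂ :=
  fun l => if hl : (l.2 : ℕ) < N then q ⟨l.2, hl⟩ else 0

/-- A polynomial in `N` variables, as a polynomial in the first `N` variables of the `k`-th
group. -/
def onFactor (hN : ∀ k, N ≤ n k) (k : Fin r) (G : MvPolynomial (Fin N) ℂ) :
    MvPolynomial (ChartIndex n) ℂ :=
  rename (fun b => (⟨k, Fin.castLE (hN k) b⟩ : ChartIndex n)) G

theorem eval_onFactor (hN : ∀ k, N ≤ n k) (k : Fin r) (G : MvPolynomial (Fin N) ℂ)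
    (q : Fin N → ℂ) : eval (diagonalPoint n q) (onFactor hN k G) = eval q G := by
  rw [onFactor, eval_rename]
  congr 2
  ext b
  simp [diagonalPoint]

theorem onFactor_mem (hN : ∀ k, N ≤ n k) (k : Fin r) {G : MvPolynomial (Fin N) ℂ} {e : ℕ}
    (hG : G ∈ restrictTotalDegree (Fin N) ℂ e) :
    onFactor hN k G ∈ degreeLE n (Pi.single k e) :=
  rename_mem_degreeLE _ hG

/-- The multidegree `1` in the factors `k₁` and `k₂`, and `2` in the others. -/
def pairDegree (k₁ k₂ : Fin r) : Fin r → ℕ := fun k => if k = k₁ ∨ k = k₂ then 1 else 2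

/-- The form is `G i (x_{k₁}) · G i (x_{k₂}) · P`: two factors vanish at each other point, and their
product is `1` at the `i`-th. Using two distinct factors costs degree `e` in each instead of `2e` in
one. -/
theorem hasLocalForms_of_succ_le {k₁ k₂ : Fin r} (hk : k₁ ≠ k₂) (hN : ∀ k, N ≤ n k) {e : ℕ}
    {q : Fin h → Fin N → ℂ} {G : Fin h → MvPolynomial (Fin N) ℂ}
    (hG : ∀ i, G i ∈ restrictTotalDegree (Fin N) ℂ e)
    (hGq : ∀ i j, eval (q j) (G i) = if i = j then 1 else 0)
    (he : ∀ k, e + 1 ≤ d k) (hd : ∀ k, 2 ≤ d k) :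
    HasLocalForms n d (pairDegree k₁ k₂) fun i => diagonalPoint n (q i) := by
  intro i P hP
  refine ⟨onFactor hN k₁ (G i) * onFactor hN k₂ (G i) * (P + 0), ?_, fun j hj => ?_, ?_⟩
  · rw [add_zero]
    refine degreeLE_mono ?_ (mul_mem_degreeLE
      (mul_mem_degreeLE (onFactor_mem hN k₁ (hG i)) (onFactor_mem hN k₂ (hG i))) hP)
    intro k
    have h1 := he k
    have h2 := hd k
    by_cases hk1 : k = k₁
    · subst hk1; simp [pairDegree, hk]; omega
    · by_cases hk2 : k = k₂
      · subst hk2; simp [pairDegree, hk1]; omega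
      · simp [pairDegree, hk1, hk2]; omega
  · refine (singularAt_mul ?_ ?_).mul_right _ <;> rw [eval_onFactor, hGq, if_neg hj.symm]
  · refine sameLeadingJet_mul_add P ?_ ⟨by simp, by simp⟩ ?_
    · simp [eval_onFactor, hGq]
    · ext; simp [hessian]

/-- With `e = d k₁` allowed, the factor `k₁` has no room for `G i` times `P`. Instead the form is `G
i (x_{k₂}) · (P + ∑ T j)`, where `T j` cancels the value of `P` at the `j`-th point and vanishes to
order three at the `i`-th: once through `G j (x_{k₁})` and twice through the square of `ℓ j`. That
square lives in the factor `k₂`, hence the surplus of two. -/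
theorem hasLocalForms_of_add_two_le {k₁ k₂ : Fin r} (hk : k₁ ≠ k₂) (hN : ∀ k, N ≤ n k) {e : ℕ}
    {q : Fin h → Fin N → ℂ} {G : Fin h → MvPolynomial (Fin N) ℂ}
    (hG : ∀ i, G i ∈ restrictTotalDegree (Fin N) ℂ e)
    (hGq : ∀ i j, eval (q j) (G i) = if i = j then 1 else 0)
    (he : e ≤ d k₁) (hd : 1 ≤ d k₁) (he2 : ∀ k, k ≠ k₁ → e + 2 ≤ d k) :
    HasLocalForms n d (pairDegree k₁ k₂) fun i => diagonalPoint n (q i) := by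
  classical
  intro i P hP
  have hne : ∀ j : {j // j ≠ i}, ∃ b, q j b ≠ q i b := by
    intro j
    by_contra! hb
    have h1 := hGq j j
    rw [funext hb, hGq, if_neg j.2, if_pos rfl] at h1
    exact zero_ne_one h1
  choose b hb using hne
  let ℓ : {j // j ≠ i} → MvPolynomial (ChartIndex n) ℂ := fun j =>
    C (q j (b j) - q i (b j))⁻¹ * (X ⟨k₂, Fin.castLE (hN k₂) (b j)⟩ - C (q i (b j)))
  have hℓ : ∀ j p, eval (diagonalPoint n p) (ℓ j)
      = (q j (b j) - q i (b j))⁻¹ * (p (b j) - q i (b j)) := by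
    intro j p
    simp [ℓ, diagonalPoint]
  have hℓi : ∀ j, eval (diagonalPoint n (q i)) (ℓ j) = 0 := fun j => by simp [hℓ]
  have hℓj : ∀ j : {j // j ≠ i}, eval (diagonalPoint n (q j)) (ℓ j) = 1 := fun j => by
    rw [hℓ, inv_mul_cancel₀ (sub_ne_zero.2 (hb j))]
  have hℓdeg : ∀ j, ℓ j ∈ degreeLE n (Pi.single k₂ 1) := by
    intro j
    rw [show ℓ j = _ from C_mul' ..]
    exact Submodule.smul_mem _ _ (X_sub_C_mem_degreeLE (⟨k₂, _⟩ : ChartIndex n) _)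
  let T : {j // j ≠ i} → MvPolynomial (ChartIndex n) ℂ := fun j =>
    C (-eval (diagonalPoint n (q j)) P) * (onFactor hN k₁ (G j) * (ℓ j * ℓ j))
  have hTs : ∀ j : {j // j ≠ i},
      SingularAt (onFactor hN k₁ (G j.1) * (ℓ j * ℓ j)) (diagonalPoint n (q i)) :=
    fun j => (singularAt_mul (hℓi j) (hℓi j)).mul_left _
  refine ⟨onFactor hN k₂ (G i) * (P + ∑ j, T j), ?_, fun j hj => ?_, ?_⟩
  · have hd2 := he2 k₂ hk.symm
    have hsum : P + ∑ j, T j ∈ degreeLE n (d - Pi.single k₂ e) := by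
      refine Submodule.add_mem _ (degreeLE_mono ?_ hP) (Submodule.sum_mem _ fun j _ => ?_)
      · intro k
        by_cases hk1 : k = k₁
        · subst hk1; simp [pairDegree, hk]; omega
        · have := he2 k hk1
          by_cases hk2 : k = k₂
          · subst hk2; simp [pairDegree]; omega
          · simp [pairDegree, hk1, hk2]; omega
      · rw [show T j = _ from C_mul' ..]
        refine Submodule.smul_mem _ _ (degreeLE_mono ?_ (mul_mem_degreeLE
          (onFactor_mem hN k₁ (hG j)) (mul_mem_degreeLE (hℓdeg j) (hℓdeg j))))
        intro k
        by_cases hk1 : k = k₁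
        · subst hk1; simp [hk]; omega
        · by_cases hk2 : k = k₂
          · subst hk2; simp [hk1]; omega
          · simp [hk1, hk2]
    refine degreeLE_mono ?_ (mul_mem_degreeLE (onFactor_mem hN k₂ (hG i)) hsum)
    intro k
    by_cases hk2 : k = k₂
    · subst hk2; simp; omega
    · simp [hk2]
  · refine singularAt_mul ?_ ?_
    · rw [eval_onFactor, hGq, if_neg hj.symm]
    · rw [map_add, map_sum, Finset.sum_eq_single (⟨j, hj⟩ : {j // j ≠ i})]
      · simp [T, eval_onFactor, hGq, hℓj ⟨j, hj⟩]
      · intro j' _ hj'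
        have : (j' : Fin h) ≠ j := fun h' => hj' (Subtype.ext h')
        simp [T, eval_onFactor, hGq, this]
      · simp
  · refine sameLeadingJet_mul_add P ?_ (SingularAt.sum fun j _ => (hTs j).mul_left _) ?_
    · simp [eval_onFactor, hGq]
    · rw [hessian_sum]
      refine Finset.sum_eq_zero fun j _ => ?_
      rw [hessian_mul_of_singularAt _ (hTs j),
        hessian_mul_of_singularAt _ (singularAt_mul (hℓi j) (hℓi j)), eval_onFactor, hGq,
        if_neg j.2, zero_smul, smul_zero]

/-- The involution of the chart coordinates that swaps the first `n k₁` coordinates of the factors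
`k₁` and `k₂`. -/
def swapCoords {k₁ k₂ : Fin r} (hle : n k₁ ≤ n k₂) (l : ChartIndex n) : ChartIndex n :=
  if h₁ : l.1 = k₁ then ⟨k₂, Fin.castLE (h₁ ▸ hle) l.2⟩
  else if h₂ : l.1 = k₂ ∧ (l.2 : ℕ) < n k₁ then ⟨k₁, l.2, h₂.2⟩ else l

theorem swapCoords_left {k₁ k₂ : Fin r} (hle : n k₁ ≤ n k₂) (b : Fin (n k₁)) :
    swapCoords hle ⟨k₁, b⟩ = ⟨k₂, Fin.castLE hle b⟩ :=
  dif_pos rfl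

theorem swapCoords_right {k₁ k₂ : Fin r} (hk : k₁ ≠ k₂) (hle : n k₁ ≤ n k₂) (b : Fin (n k₂))
    (hb : (b : ℕ) < n k₁) : swapCoords hle ⟨k₂, b⟩ = ⟨k₁, b, hb⟩ := by
  rw [swapCoords, dif_neg hk.symm, dif_pos ⟨rfl, hb⟩]

theorem swapCoords_of_not {k₁ k₂ : Fin r} (hle : n k₁ ≤ n k₂) {l : ChartIndex n} (h₁ : l.1 ≠ k₁)
    (h₂ : ¬ (l.1 = k₂ ∧ (l.2 : ℕ) < n k₁)) : swapCoords hle l = l := by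
  rw [swapCoords, dif_neg h₁, dif_neg h₂]

theorem swapCoords_involutive {k₁ k₂ : Fin r} (hk : k₁ ≠ k₂) (hle : n k₁ ≤ n k₂) :
    Function.Involutive (swapCoords hle) := by
  rintro ⟨k, b⟩
  by_cases hk1 : k = k₁
  · subst hk1
    rw [swapCoords_left, swapCoords_right hk hle _ b.2]
    rfl
  · by_cases hk2 : k = k₂ ∧ (b : ℕ) < n k₁
    · obtain ⟨rfl, hb⟩ := hk2
      rw [swapCoords_right hk hle b hb, swapCoords_left]
      rfl
    · have := swapCoords_of_not hle (l := ⟨k, b⟩) hk1 hk2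
      rw [this, this]

/-- Swapped pairs have degree one in both `k₁` and `k₂`, and squares in the other factors have
degree two, so both fit `pairDegree`. The coordinates of `k₂` beyond the first `n k₁` are the
padding zeros of the diagonal points. -/
theorem special_of_hasLocalForms [DecidableEq (ChartIndex n)] {k₁ k₂ : Fin r} (hk : k₁ ≠ k₂)
    (hle : n k₁ ≤ n k₂)
    (hd : 2 ≤ d k₂) {q : Fin h → Fin (n k₁) → ℂ}
    (hloc : HasLocalForms n d (pairDegree k₁ k₂) fun i => diagonalPoint n (q i)) :
    Function.Surjective (jetMatrix d fun i => diagonalPoint n (q i)).mulVec ∧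
      ∀ i, ∃ H ∈ singularForms d fun i => diagonalPoint n (q i),
        (hessian (chartForm H) (diagonalPoint n (q i))).det ≠ 0 := by
  refine ⟨hloc.surjective_jetMatrix fun k => ?_,
    hloc.exists_hessian (swapCoords_involutive hk hle) ?_⟩
  · unfold pairDegree; split_ifs <;> omega
  · rintro ⟨k, b⟩
    by_cases hk1 : k = k₁
    · subst hk1
      left
      intro j
      rw [swapCoords_left]
      simp only [Pi.add_apply, Pi.single_apply, pairDegree]
      by_cases h1 : j = k
      · subst h1; simp [hk]
      · by_cases h2 : j = k₂ <;> simp [h1, h2, hk.symm]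
    · by_cases hk2 : k = k₂
      · subst hk2
        by_cases hb : (b : ℕ) < n k₁
        · left
          intro j
          rw [swapCoords_right hk hle b hb]
          simp only [Pi.add_apply, Pi.single_apply, pairDegree]
          by_cases h1 : j = k
          · subst h1; simp [hk.symm]
          · by_cases h2 : j = k₁ <;> simp [h1, h2, hk]
        · right
          refine ⟨swapCoords_of_not hle hk1 fun h => hb h.2, hd, fun j => ?_⟩
          simp [diagonalPoint, hb]
      · left
        intro j
        rw [swapCoords_of_not hle hk1 fun h => hk2 h.1]
        simp only [Pi.add_apply, Pi.single_apply, pairDegree]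
        by_cases hj : j = k
        · subst hj; simp [hk1, hk2]
        · simp [hj]

end SpecialPoints

/-! ### Points imposing independent conditions -/

section Interpolation

/-- Induction: by dimension some nonzero `g` in `V` vanishes at the points found so far. Any point
where `g` is nonzero is the next one, and multiples of `g` correct the earlier `G i`. -/
theorem exists_dual_points {σ : Type*} (V : Submodule ℂ (MvPolynomial σ ℂ)) [Module.Finite ℂ V]
    (h : ℕ) (hh : h ≤ Module.finrank ℂ V) :
    ∃ (q : Fin h → σ → ℂ) (G : Fin h → MvPolynomial σ ℂ), (∀ i, G i ∈ V) ∧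
      ∀ i j, eval (q j) (G i) = if i = j then 1 else 0 := by
  induction h with
  | zero => exact ⟨fun _ _ => 0, fun _ => 0, fun i => i.elim0, fun i => i.elim0⟩
  | succ h ih =>
    obtain ⟨q, G, hG, hGq⟩ := ih (by omega)
    let ev : V →ₗ[ℂ] Fin h → ℂ :=
      LinearMap.pi fun j => (aeval (R := ℂ) (q j)).toLinearMap ∘ₗ V.subtype
    have hker : LinearMap.ker ev ≠ ⊥ := LinearMap.ker_ne_bot_of_finrank_lt (by simpa using hh)
    obtain ⟨g, hg, hg0⟩ := Submodule.exists_mem_ne_zero_of_ne_bot hker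
    have hgq : ∀ j, eval (q j) g.1 = 0 := fun j => by
      have := congrFun (LinearMap.mem_ker.1 hg) j
      rw [← coe_aeval_eq_eval]
      exact this
    obtain ⟨x, hx⟩ : ∃ x, eval x g.1 ≠ 0 := by
      by_contra! H
      exact hg0 (Subtype.ext (MvPolynomial.funext fun x => by simpa using H x))
    refine ⟨Fin.snoc q x,
      Fin.snoc (fun i => G i - (eval x (G i) / eval x g.1) • g.1) ((eval x g.1)⁻¹ • g.1), ?_, ?_⟩
    · intro i
      refine Fin.lastCases ?_ (fun i => ?_) i
      · simpa using V.smul_mem _ g.2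
      · simpa using V.sub_mem (hG i) (V.smul_mem _ g.2)
    · intro i j
      refine Fin.lastCases ?_ (fun i => ?_) i <;> refine Fin.lastCases ?_ (fun j => ?_) j
      · simp [smul_eval, hx]
      · simp [smul_eval, hgq, (Fin.castSucc_lt_last j).ne']
      · simp [smul_eval, hx, (Fin.castSucc_lt_last i).ne]
      · simp [smul_eval, hgq, hGq, Fin.castSucc_inj]

end Interpolation

/-! ### Counting monomials -/

section Count

/-- The number of monomials of degree at most `e` in `N` variables. -/
def monomialCount (N e : ℕ) : ℕ := Nat.card {s : Fin N → ℕ // ∑ b, s b ≤ e}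

instance (N e : ℕ) : Finite {s : Fin N → ℕ // ∑ b, s b ≤ e} := by
  refine Finite.of_injective
    (fun s (b : Fin N) => (⟨s.1 b, Nat.lt_succ_of_le
      ((Finset.single_le_sum (fun _ _ => Nat.zero_le _) (Finset.mem_univ b)).trans s.2)⟩ :
        Fin (e + 1))) fun s u hsu => ?_
  ext b
  simpa using congrFun hsu b

theorem finrank_restrictTotalDegree (N e : ℕ) :
    Module.finrank ℂ (restrictTotalDegree (Fin N) ℂ e) = monomialCount N e := by
  rw [restrictTotalDegree, Module.finrank_eq_nat_card_basis (basisRestrictSupport ℂ _),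
    monomialCount]
  refine Nat.card_congr (Equiv.subtypeEquiv Finsupp.equivFunOnFinite fun s => ?_)
  rw [Set.mem_ofPred_eq, Finsupp.sum_fintype _ _ fun _ => rfl]
  rfl

/-- Squaring a monomial and multiplying it by `1` or by one variable is injective, since the
parities of the exponents reveal the extra factor. -/
theorem succ_mul_monomialCount_le (N e : ℕ) :
    (N + 1) * monomialCount N e ≤ monomialCount N (2 * e + 1) := by
  have h1 : (N + 1) * monomialCount N e
      = Nat.card (Option (Fin N) × {s : Fin N → ℕ // ∑ b, s b ≤ e}) := by
    rw [Nat.card_prod, monomialCount]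
    simp
  rw [h1]
  refine Nat.card_le_card_of_injective
    (fun p => ⟨fun b => 2 * p.2.1 b + if p.1 = some b then 1 else 0, ?_⟩) ?_
  · rw [Finset.sum_add_distrib, ← Finset.mul_sum]
    have h2 := p.2.2
    have h3 : ∑ b, (if p.1 = some b then 1 else 0) ≤ 1 := by
      rcases p.1 with _ | a <;> simp
    omega
  · rintro ⟨o, s⟩ ⟨o', s'⟩ heq
    have hb : ∀ b, 2 * s.1 b + (if o = some b then 1 else 0)
        = 2 * s'.1 b + if o' = some b then 1 else 0 := fun b =>
      congrFun (congrArg Subtype.val heq) b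
    have hs : s = s' := by
      ext b
      have := hb b
      split_ifs at this <;> omega
    have ho : ∀ b, o = some b ↔ o' = some b := by
      intro b
      have := hb b
      split_ifs at this with h1 h2 <;> simp_all
    rw [hs, Option.ext (fun b => ho b)]

theorem monomialCount_succ_le {N : ℕ} (hN : 1 ≤ N) (e : ℕ) :
    monomialCount N e + 1 ≤ monomialCount N (e + 1) := by
  have h1 : monomialCount N e + 1 = Nat.card (Option {s : Fin N → ℕ // ∑ b, s b ≤ e}) := by
    rw [Finite.card_option, monomialCount]
  rw [h1]
  let top : Fin N → ℕ := Pi.single ⟨0, hN⟩ (e + 1)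
  have htop : ∑ b, top b = e + 1 := by simp [top]
  refine Nat.card_le_card_of_injective (fun o => o.elim ⟨top, htop.le⟩
    fun s => ⟨s.1, s.2.trans (Nat.le_succ e)⟩) ?_
  rintro (_ | s) (_ | u) heq
  · rfl
  · have h2 : top = u.1 := congrArg Subtype.val heq
    have := u.2
    rw [← h2] at this
    omega
  · have h2 : s.1 = top := congrArg Subtype.val heq
    have := s.2
    rw [h2] at this
    omega
  · have h2 : s.1 = u.1 := congrArg (fun z => z.1) heq
    rw [Subtype.ext h2]

theorem one_le_monomialCount (N e : ℕ) : 1 ≤ monomialCount N e := by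
  have : Nonempty {s : Fin N → ℕ // ∑ b, s b ≤ e} := ⟨⟨0, by simp⟩⟩
  exact Nat.card_pos

/-- Halving `K` drops its last binary digit and divides the remaining terms by `N + 1`, which
`succ_mul_monomialCount_le` compensates. For odd `K` the digit `1` is absorbed by raising the degree
by one. -/
theorem sum_testBit_le_monomialCount {N : ℕ} (hN : 1 ≤ N) (L K : ℕ) (hK : 1 ≤ K) :
    (∑ l ∈ Finset.range L, if K.testBit l then (N + 1) ^ l else 0) ≤ monomialCount N (K - 1) := by
  induction L generalizing K with
  | zero => simp
  | succ L ih =>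
    have h1 : (∑ l ∈ Finset.range L, if K.testBit (l + 1) then (N + 1) ^ (l + 1) else 0)
        = (N + 1) * ∑ l ∈ Finset.range L, if (K / 2).testBit l then (N + 1) ^ l else 0 := by
      rw [Finset.mul_sum]
      refine Finset.sum_congr rfl fun l _ => ?_
      rw [Nat.testBit_succ]
      split_ifs
      · ring
      · simp
    rw [Finset.sum_range_succ', h1, pow_zero]
    rcases Nat.eq_zero_or_pos (K / 2) with h0 | h0
    · have hK1 : K = 1 := by omega
      subst hK1
      simpa using one_le_monomialCount N 0
    · have h2 := ih (K / 2) h0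
      have h3 := Nat.mul_le_mul_left (N + 1) h2
      have h4 := succ_mul_monomialCount_le N (K / 2 - 1)
      rcases Nat.even_or_odd' K with ⟨c, rfl | rfl⟩
      · have e1 : 2 * (2 * c / 2 - 1) + 1 = 2 * c - 1 := by omega
        rw [e1] at h4
        simpa using h3.trans h4
      · have e1 : 2 * ((2 * c + 1) / 2 - 1) + 1 = 2 * c - 1 := by omega
        rw [e1] at h4
        have h5 := monomialCount_succ_le hN (2 * c - 1)
        have e2 : 2 * c - 1 + 1 = 2 * c + 1 - 1 := by omega
        rw [e2] at h5
        have h6 : (if (2 * c + 1).testBit 0 = true then 1 else 0) ≤ 1 := by split_ifs <;> simp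
        exact (add_le_add (h3.trans h4) h6).trans h5

theorem mul_osculatingCount_le {N : ℕ} (hN : 1 ≤ N) (k : ℕ) :
    (N + 1) * osculatingCount (N + 1) k ≤ monomialCount N k := by
  have h1 := sum_testBit_le_monomialCount hN (k + 2) (k + 1) (by omega)
  rw [Nat.add_sub_cancel] at h1
  refine le_trans ?_ h1
  -- The factor `N + 1` undoes the shift `l - 1` in the exponents; digit `0`, absent from
  -- `osculatingCount`, is discarded.
  rw [osculatingCount, Finset.mul_sum]
  refine (Finset.sum_le_sum fun l hl => ?_).trans (Finset.sum_le_sum_of_subset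
    (s := Finset.Icc 1 (k + 1)) fun l hl => ?_)
  · split_ifs
    · rw [← pow_succ', Nat.sub_add_cancel (Finset.mem_Icc.1 hl).1]
    · simp
  · rw [Finset.mem_range]
    have := (Finset.mem_Icc.1 hl).2
    omega

theorem pow_log_le_monomialCount {N K : ℕ} (hN : 1 ≤ N) (hK : 1 ≤ K) :
    (N + 1) ^ Nat.log 2 K ≤ monomialCount N (K - 1) := by
  refine le_trans ?_ (sum_testBit_le_monomialCount hN (Nat.log 2 K + 1) K hK)
  have hbit : K.testBit (Nat.log 2 K) = true := by
    rw [← Nat.log2_eq_log_two]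
    exact Nat.testBit_log2 (by omega)
  refine le_trans ?_ (Finset.single_le_sum (fun _ _ => Nat.zero_le _)
    (Finset.mem_range.2 (Nat.lt_succ_self (Nat.log 2 K))))
  rw [if_pos hbit]

end Count

end SegreVeronese

end

/-! ### Conclusion: the three numerical cases. -/

theorem mainTheorem1 (r : ℕ) (hr : 2 ≤ r) (n d : Fin r → ℕ)
    (hn : ∀ i, 1 ≤ n i) (hd : ∀ i, 1 ≤ d i) (hmono : Monotone n)
    (n₁ d₁ : ℕ) (hn₁ : n₁ = n ⟨0, by omega⟩) (hd₁ : d₁ = d ⟨0, by omega⟩)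
    (dmin : ℕ) (hdmin : IsLeast (Set.range d) dmin)
    (h : ℕ) (hh : 1 ≤ h)
    (hbound :
      h ≤ (n₁ + 1) * SegreVeronese.osculatingCount (n₁ + 1) (dmin - 1) ∨
      (h ≤ (n₁ + 1) * SegreVeronese.osculatingCount (n₁ + 1) dmin ∧
        dmin = d₁ ∧ ∀ i : Fin r, 1 ≤ (i : ℕ) → d₁ + 2 ≤ d i) ∨
      (2 ≤ dmin ∧ h ≤ (n₁ + 1) ^ Nat.log 2 dmin)) :
    ¬ SegreVeronese.IsWeaklyDefective (SegreVeronese.segreVeronese n d) h ∧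
      ¬ SegreVeronese.IsDefective (SegreVeronese.segreVeronese n d) h := by
  classical
  set k₁ : Fin r := ⟨0, by omega⟩ with hk₁
  set k₂ : Fin r := ⟨1, by omega⟩ with hk₂
  have hk : k₁ ≠ k₂ := by simp [hk₁, hk₂]
  have hN : ∀ k, n k₁ ≤ n k := fun k => hmono (Fin.mk_le_of_le_val (Nat.zero_le _))
  have hn1 : 1 ≤ n₁ := hn₁ ▸ hn k₁
  have hdle : ∀ k, dmin ≤ d k := fun k => hdmin.2 ⟨k, rfl⟩
  have hloc : 2 ≤ d k₂ ∧ ∃ q : Fin h → Fin (n k₁) → ℂ, SegreVeronese.HasLocalForms n d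
      (SegreVeronese.pairDegree k₁ k₂) fun i => SegreVeronese.diagonalPoint n (q i) := by
    -- The first and third bounds both lead to interpolation in degree `dmin - 1`, the second to
    -- degree `dmin`.
    have hcase : (2 ≤ dmin ∧ h ≤ SegreVeronese.monomialCount n₁ (dmin - 1)) ∨
        (h ≤ SegreVeronese.monomialCount n₁ dmin ∧
          dmin = d₁ ∧ ∀ i : Fin r, 1 ≤ (i : ℕ) → d₁ + 2 ≤ d i) := by
      rcases hbound with h1 | ⟨h1, h2⟩ | ⟨h1, h2⟩
      · left
        refine ⟨?_, h1.trans (SegreVeronese.mul_osculatingCount_le hn1 _)⟩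
        -- If `dmin = 1`, the first bound reads `h ≤ 0`.
        by_contra hlt
        have : dmin - 1 = 0 := by omega
        rw [this, show SegreVeronese.osculatingCount (n₁ + 1) 0 = 0 by
          simp [SegreVeronese.osculatingCount, Nat.testBit_succ]] at h1
        omega
      · exact Or.inr ⟨h1.trans (SegreVeronese.mul_osculatingCount_le hn1 _), h2⟩
      · exact Or.inl ⟨h1, h2.trans (SegreVeronese.pow_log_le_monomialCount hn1 (by omega))⟩
    rw [hn₁] at hcase
    rcases hcase with ⟨h2, hcount⟩ | ⟨hcount, hdm, hi⟩
    · rw [← SegreVeronese.finrank_restrictTotalDegree] at hcount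
      obtain ⟨q, G, hG, hGq⟩ := SegreVeronese.exists_dual_points _ h hcount
      exact ⟨h2.trans (hdle k₂), q, SegreVeronese.hasLocalForms_of_succ_le hk hN hG hGq
        (fun k => by have := hdle k; omega) fun k => h2.trans (hdle k)⟩
    · rw [← SegreVeronese.finrank_restrictTotalDegree] at hcount
      obtain ⟨q, G, hG, hGq⟩ := SegreVeronese.exists_dual_points _ h hcount
      refine ⟨le_trans (by omega) (hi k₂ le_rfl), q,
        SegreVeronese.hasLocalForms_of_add_two_le hk hN hG hGq (hdle k₁) (hd k₁) fun k hkk => ?_⟩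
      rw [hdm]
      refine hi k (Nat.one_le_iff_ne_zero.2 fun h0 => hkk (Fin.ext h0))
  obtain ⟨hd2, q, hloc⟩ := hloc
  obtain ⟨hjet, hess⟩ := SegreVeronese.special_of_hasLocalForms hk (hN k₂) hd2 hloc
  exact ⟨SegreVeronese.not_isWeaklyDefective_of_special hd _ hjet hess,
    SegreVeronese.not_isDefective_of_special hh _ hjet⟩
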